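/- **Theorem.** Consider a two-armed stochastic bandit: the rewards of arm $k\in\{1,2\}$ are i.i.d. with mean $\mu_k$ and a 1-subgaussian distribution, i.e. $\mathbb{E}[\exp(\lambda (X-\mu_k))]\le \exp(\lambda^2/2)$ for all $\lambda\in\mathbb{R}$, the rewards of the two arms are independent, and $\Delta=|\mu_1-\mu_2|>0$. At each time step $t$ an algorithm pulls an arm $A_t$ and receives a reward $r_t$ of that arm. Let $T_k(t)$ be the number of pulls of arm $k$ in the first $t$ steps, $\hat\mu_k(t)$ the average of the rewards obtained from arm $k$ in these steps, and $\log^+ x=\max\{0,\log x\}$. The algorithm DETC (Double Explore-then-Commit for an unknown gap) with inputs $T$ and $T_1$, which does not know $\Delta$, is the following; every pull increases $t$ by one. - *Initialization.* Pull arm 1, then arm 2 (so $t=2$). - *Stage I.* While $|\hat\mu_1(t)-\hat\mu_2(t)|<\sqrt{\tfrac{16}{t}\log^+(T_1/t)}$: pull arm 1, then arm 2. - *Stage II.* Let $1'=\arg\max_i\hat\mu_i(t)$ (ties resolved in favour of a fixed arm) and let $2'$ be the other arm. While $T_{1'}(t)\le T_1$: pull arm $1'$. - *Stage III.* Let $\mu'=\hat\mu_{1'}(t)$.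 Pull arm $2'$ once. Denoting by $t_2$ the number of pulls of arm $2'$ made so far in this stage and by $\theta_{2',t_2}$ the average of the rewards of these $t_2$ pulls, while $$|\mu'-\theta_{2',t_2}|<\sqrt{\tfrac{2}{t_2}\log\Big(\tfrac{T}{t_2}\big(\log^2(T/t_2)+1\big)\Big)}:$$ pull arm $2'$. - *Stage IV.* Let $a=1'$ if $\hat\mu_{1'}(t)\ge\theta_{2',t_2}$ and $a=2'$ otherwise. While $t\le T$: pull arm $a$. Let $R(T)=T\max\{\mu_1,\mu_2\}-\mathbb{E}\big[\sum_{t=1}^{T} r_t\big]$ be the expected cumulative regret of DETC run with inputs $T$ and $T_1=\log^2 T=(\log T)^2$. Then $$\lim_{T\to\infty}\frac{R(T)}{\log T}=\frac{2}{\Delta},$$ that is, the asymptotic regret rate of DETC equals $2/\Delta$. -/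

import Mathlib

open MeasureTheory ProbabilityTheory Filter Topology

noncomputable section

namespace DETC

/-- The history `(A_1, r_1), …, (A_t, r_t)` in chronological order: the arm pulled at each time step
and the reward observed. The two arms `1, 2` are `0, 1 : Fin 2`. -/
abbrev History := List (Fin 2 × ℝ)

/-- The current time step `t`. -/
def time (h : History) : ℕ := h.length

/-- `T_k(t)`: the number of times that arm `k` has been pulled so far. -/
def pulls (k : Fin 2) (h : History) : ℕ := h.countP (fun p => p.1 = k)

/-- `μ̂_k(t)`: the average of the rewards received so far from arm `k`. -/
def avg (k : Fin 2) (h : History) : ℝ :=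
  (h.map (fun p => if p.1 = k then p.2 else 0)).sum / pulls k h

/-- Pull arm `k` once: the history is extended by `k` and the observed reward. Here `x k n` is the
reward of pull number `n + 1` of arm `k`. -/
def pull (x : Fin 2 → ℕ → ℝ) (k : Fin 2) (h : History) : History :=
  h ++ [(k, x k (pulls k h))]

/-- `while cond do body`, started in `s`: the body is repeated as long as the condition holds.
(All the loops below halt on every reward sequence.) -/
def whileLoop {σ : Type} (cond : σ → Prop) (body : σ → σ) (s : σ) : σ :=
  body^[sInf {n : ℕ | ¬ cond (body^[n] s)}] s

/-- `log⁺ x = max {0, log x}`. -/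
def logPlus (x : ℝ) : ℝ := max 0 (Real.log x)

/-- Initialization: pull arm 1, then arm 2. -/
def init (x : Fin 2 → ℕ → ℝ) : History := pull x 1 (pull x 0 [])

/-- Stage I: while `|μ̂₁(t) - μ̂₂(t)| < √((16 / t) log⁺(T₁ / t))`, pull arm 1 and then arm 2. -/
def stageI (x : Fin 2 → ℕ → ℝ) (T₁ : ℝ) (h : History) : History :=
  whileLoop
    (fun h => |avg 0 h - avg 1 h| < √(16 / time h * logPlus (T₁ / time h)))
    (fun h => pull x 1 (pull x 0 h)) h

/-- The arm with the largest average reward; `tie` is the arm taken if the averages are equal. -/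
def bestArm (tie : Fin 2) (h : History) : Fin 2 :=
  if avg 1 h < avg 0 h then 0 else if avg 0 h < avg 1 h then 1 else tie

/-- Stage II: while `T_i(t) ≤ T₁`, pull arm `i`. -/
def stageII (x : Fin 2 → ℕ → ℝ) (T₁ : ℝ) (i : Fin 2) (h : History) : History :=
  whileLoop (fun h => (pulls i h : ℝ) ≤ T₁) (pull x i) h

/-- The variables of Stage III: the history, the number `t₂` of pulls made in this stage, and the
average `θ` of the rewards observed in this stage. -/
structure StateIII where
  hist : History
  t₂ : ℕ
  θ : ℝ

/-- One pull of arm `j` in Stage III: with the observed reward `r`,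
`θ ← (t₂ θ + r) / (t₂ + 1)` and `t₂ ← t₂ + 1`. -/
def stepIII (x : Fin 2 → ℕ → ℝ) (j : Fin 2) (s : StateIII) : StateIII where
  hist := pull x j s.hist
  t₂ := s.t₂ + 1
  θ := (s.t₂ * s.θ + x j (pulls j s.hist)) / (s.t₂ + 1)

/-- Stage III: pull arm `j` once; then, while
`|μ' - θ| < √((2 / t₂) log((T / t₂) (log²(T / t₂) + 1)))`, pull arm `j`. -/
def stageIII (x : Fin 2 → ℕ → ℝ) (T : ℕ) (j : Fin 2) (μ' : ℝ) (h : History) : StateIII :=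
  whileLoop
    (fun s => |μ' - s.θ| <
      √(2 / s.t₂ * Real.log (T / s.t₂ * (Real.log (T / s.t₂) ^ 2 + 1))))
    (stepIII x j) (stepIII x j ⟨h, 0, 0⟩)

/-- Stage IV: while `t ≤ T`, pull arm `a`. -/
def stageIV (x : Fin 2 → ℕ → ℝ) (T : ℕ) (a : Fin 2) (h : History) : History :=
  whileLoop (fun h => time h ≤ T) (pull x a) h

/-- Double Explore-then-Commit for an unknown gap, with inputs `T` and `T₁`: the history it produces
when the successive rewards of arm `k` are `x k 0, x k 1, …`. -/
def run (tie : Fin 2) (T : ℕ) (T₁ : ℝ) (x : Fin 2 → ℕ → ℝ) : History :=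
  let h₁ := stageI x T₁ (init x)
  -- the arm `1'` with the largest average, and the other arm `2'`
  let i := bestArm tie h₁
  let j := 1 - i
  let h₂ := stageII x T₁ i h₁
  let s := stageIII x T j (avg i h₂) h₂
  let a := if s.θ ≤ avg i s.hist then i else j
  stageIV x T a s.hist

/-- `∑_{t=1}^T r_t`, the total reward of the first `T` time steps. -/
def totalReward (tie : Fin 2) (T : ℕ) (T₁ : ℝ) (x : Fin 2 → ℕ → ℝ) : ℝ :=
  (((run tie T T₁ x).take T).map Prod.snd).sum

/-- The mean reward `μ_k` of an arm with reward distribution `ν k`. -/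
def mean (ν : Fin 2 → Measure ℝ) (k : Fin 2) : ℝ := ∫ y, y ∂(ν k)

/-- The arm `k` has a 1-subgaussian reward distribution: with `Y ∼ ν k`,
`𝔼[exp(s (Y - 𝔼 Y))] ≤ exp(s² / 2)` for all real `s`. -/
def IsOneSubgaussian (ν : Fin 2 → Measure ℝ) (k : Fin 2) : Prop :=
  HasSubgaussianMGF (fun y => y - mean ν k) 1 (ν k)

/-- `X k n` is the reward of pull number `n + 1` of arm `k`: all these random variables are
independent, and those of arm `k` have distribution `ν k`. -/
structure IsRewardTable {Ω : Type*} [MeasurableSpace Ω] (P : Measure Ω)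
    (ν : Fin 2 → Measure ℝ) (X : Fin 2 → ℕ → Ω → ℝ) : Prop where
  measurable : ∀ k n, Measurable (X k n)
  law : ∀ k n, P.map (X k n) = ν k
  indep : iIndepFun (fun p : Fin 2 × ℕ => X p.1 p.2) P

/-- The expected cumulative regret `R(T) = T max {μ₁, μ₂} - 𝔼[∑_{t=1}^T r_t]`. -/
def regret {Ω : Type*} [MeasurableSpace Ω] (P : Measure Ω) (ν : Fin 2 → Measure ℝ)
    (X : Fin 2 → ℕ → Ω → ℝ) (tie : Fin 2) (T : ℕ) (T₁ : ℝ) : ℝ :=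
  T * max (mean ν 0) (mean ν 1) - ∫ ω, totalReward tie T T₁ (fun k n => X k n ω) ∂P

end DETC

end

/-!
The regret equals `Δ` times the expected number of pulls of the worse arm `b` (`regret_eq`). This is
Wald's identity, and it rests on non-anticipation: whether arm `k` is pulled more than `n` times up
to time `T` does not depend on the reward of pull number `n + 1` of that arm (`lt_armCount_iff`).
Two runs on tables that differ in this one reward coincide until they both use it, which is shown by
coupling the loops of the algorithm (`whileLoop_coupling`).

A run is described by four discrete quantities (`run_eq_schedule`): the number `s` of rounds of
Stage I (`pairCount`), the arm chosen after it (`leader`), the number `m` of pulls in Stage III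
(`testLength`), and the arm pulled in Stage IV (`winner`). The arm chosen in Stage I has
`N = ⌊T₁⌋ + 1` pulls after Stage II, whatever the rewards are, and `s ≤ N`. So every statistic that
the algorithm compares with a threshold is the average of a block of consecutive rewards of an arm,
and since `N` is about `log² T`, union bounds over the random starting point `s` of the blocks of
Stage III cost only a factor of order `log² T`. Chernoff's bound for one block
(`measureReal_deviation_le`) is the only probabilistic estimate needed, with `L = log T`:

* Stage I takes at most `η L` rounds, for any `η > 0`, outside an event of probability
  `T ^ (-c)` (`measureReal_lt_pairCount_le`), and it picks the worse arm with probability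
  `O(1 / T₁) = O(1 / L²)`, which makes up for the `O(L²)` pulls of Stage II
  (`measureReal_leader_le`).
* The average of the leader after Stage II is within `ε` of its mean outside an event of probability
  `exp (-ε² L² / 2) = o(1 / T)`.
* If the leader is the better arm, Stage III compares a number close to `Δ` with a threshold of size
  about `√(2 L / m)`, so it ends at `m ≈ 2 L / Δ²`; this is the main term
  (`measureReal_lt_testLength_le`, `measureReal_testLength_lt_le`).
* Stage IV repeats the worse arm with probability `O(1 / T)`. The factor `log² (T / m) + 1` in the
  threshold of Stage III yields the bound `O(1 / (T L²))` for each `s`, and there are `O(L²)` values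
  of `s` (`exp_neg_radiusIII_le`, `measureReal_winner_le`).

Hence the expected number of pulls of the worse arm is `(2 / Δ² + o(1)) L`.
-/

noncomputable section

namespace DETC

/-! ### While loops -/

theorem whileLoop_eq_iterate {σ : Type} {cond : σ → Prop} {body : σ → σ} {s : σ} {n : ℕ}
    (hlt : ∀ k < n, cond (body^[k] s)) (hn : ¬ cond (body^[n] s)) :
    whileLoop cond body s = body^[n] s := by
  have h : sInf {n : ℕ | ¬ cond (body^[n] s)} = n := by
    refine le_antisymm (Nat.sInf_le hn) (not_lt.1 fun h => ?_)
    exact Nat.sInf_mem (s := {n : ℕ | ¬ cond (body^[n] s)}) ⟨n, hn⟩ (hlt _ h)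
  rw [whileLoop, h]

theorem exists_whileLoop_eq_iterate {σ : Type} {cond : σ → Prop} {body : σ → σ} {s : σ}
    (h : ∃ n, ¬ cond (body^[n] s)) :
    ∃ n, whileLoop cond body s = body^[n] s ∧ (∀ k < n, cond (body^[k] s)) ∧
      ¬ cond (body^[n] s) := by
  refine ⟨sInf {n : ℕ | ¬ cond (body^[n] s)}, rfl, fun k hk => ?_, Nat.sInf_mem h⟩
  exact not_not.1 (Nat.notMem_of_lt_sInf hk)

/-- Two runs of a loop with the same condition and different bodies either stay equal (with `U`
holding along the way) or, from the first iteration at which the bodies differ, satisfy a relation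
`D` that no further iteration destroys. -/
theorem whileLoop_coupling {σ : Type} {cond : σ → Prop} {f g : σ → σ} {U : σ → Prop}
    {D : σ → σ → Prop} (hstep : ∀ s, U s → (f s = g s ∧ U (g s)) ∨ D (f s) (g s))
    (hl : ∀ s s', D s s' → D (f s) s') (hr : ∀ s s', D s s' → D s (g s')) {s : σ} (hs : U s)
    (hf : ∃ n, ¬ cond (f^[n] s)) (hg : ∃ n, ¬ cond (g^[n] s)) :
    (whileLoop cond f s = whileLoop cond g s ∧ U (whileLoop cond g s)) ∨
      D (whileLoop cond f s) (whileLoop cond g s) := by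
  obtain ⟨n, hn, hnlt, hnn⟩ := exists_whileLoop_eq_iterate hf
  obtain ⟨n', hn', hnlt', hnn'⟩ := exists_whileLoop_eq_iterate hg
  have key : ∀ k, (f^[k] s = g^[k] s ∧ U (g^[k] s)) ∨ D (f^[k] s) (g^[k] s) := by
    intro k
    induction k with
    | zero => exact Or.inl ⟨rfl, hs⟩
    | succ k ih =>
      rw [Function.iterate_succ_apply', Function.iterate_succ_apply']
      rcases ih with ⟨h, hU⟩ | h
      · rw [h]; exact hstep _ hU
      · exact Or.inr (hr _ _ (hl _ _ h))
  have hl' : ∀ d k s', D (f^[k] s) s' → D (f^[k + d] s) s' := by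
    intro d k s' h
    induction d with
    | zero => exact h
    | succ d ih => rw [← add_assoc, Function.iterate_succ_apply']; exact hl _ _ ih
  have hr' : ∀ d k s', D s' (g^[k] s) → D s' (g^[k + d] s) := by
    intro d k s' h
    induction d with
    | zero => exact h
    | succ d ih => rw [← add_assoc, Function.iterate_succ_apply']; exact hr _ _ ih
  rw [hn, hn']
  rcases lt_trichotomy n n' with h | h | h
  · rcases key n with ⟨e, -⟩ | hD
    · exact absurd (e ▸ hnlt' n h) hnn
    · right; obtain ⟨d, rfl⟩ := Nat.exists_eq_add_of_le h.le
      exact hr' _ _ _ hD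
  · subst h; exact key n
  · rcases key n' with ⟨e, -⟩ | hD
    · exact absurd (e ▸ hnlt n' h) hnn'
    · right; obtain ⟨d, rfl⟩ := Nat.exists_eq_add_of_le h.le
      exact hl' _ _ _ hD

/-! ### Histories produced by pulling arms -/

section Histories

variable (x : Fin 2 → ℕ → ℝ)

theorem pulls_pull (k k' : Fin 2) (h : History) :
    pulls k' (pull x k h) = pulls k' h + if k = k' then 1 else 0 := by
  simp [pulls, pull, List.countP_append, List.countP_cons]

theorem pulls_iterate_pull (k k' : Fin 2) (n : ℕ) (h : History) :
    pulls k' ((pull x k)^[n] h) = pulls k' h + if k = k' then n else 0 := by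
  induction n with
  | zero => simp
  | succ n ih =>
    rw [Function.iterate_succ_apply', pulls_pull, ih]
    split_ifs <;> omega

theorem length_pull (k : Fin 2) (h : History) : (pull x k h).length = h.length + 1 := by
  simp [pull]

theorem length_iterate_pull (k : Fin 2) (n : ℕ) (h : History) :
    ((pull x k)^[n] h).length = h.length + n := by
  induction n with
  | zero => simp
  | succ n ih => rw [Function.iterate_succ_apply', length_pull, ih]; omega

/-- The history after `n` rounds in which arm 1 and then arm 2 is pulled. -/
def pairHistory (n : ℕ) : History := (fun h => pull x 1 (pull x 0 h))^[n] []

theorem pairHistory_succ (n : ℕ) :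
    pairHistory x (n + 1) = pull x 1 (pull x 0 (pairHistory x n)) :=
  Function.iterate_succ_apply' _ _ _

theorem pulls_pairHistory (k : Fin 2) (n : ℕ) : pulls k (pairHistory x n) = n := by
  induction n with
  | zero => rfl
  | succ n ih =>
    rw [pairHistory_succ, pulls_pull, pulls_pull, ih]
    fin_cases k <;> simp

theorem length_pairHistory (n : ℕ) : (pairHistory x n).length = 2 * n := by
  induction n with
  | zero => rfl
  | succ n ih => rw [pairHistory_succ, length_pull, length_pull, ih]; omega

theorem prefix_pull (k : Fin 2) (h : History) : h <+: pull x k h := List.prefix_append _ _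

theorem prefix_iterate_pull (k : Fin 2) (n : ℕ) (h : History) : h <+: (pull x k)^[n] h := by
  induction n with
  | zero => exact List.prefix_rfl
  | succ n ih => rw [Function.iterate_succ_apply']; exact ih.trans (prefix_pull x k _)

theorem pulls_mono_prefix (k : Fin 2) {h h' : History} (hp : h <+: h') : pulls k h ≤ pulls k h' :=
  hp.sublist.countP_le

theorem pulls_le_length (k : Fin 2) (h : History) : pulls k h ≤ h.length := List.countP_le_length

theorem pulls_add_pulls (h : History) : pulls 0 h + pulls 1 h = h.length := by
  induction h with
  | nil => rfl
  | cons p h ih =>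
    have h2 : p.1 = 0 ∨ p.1 = 1 := by omega
    simp only [pulls, List.countP_cons, List.length_cons] at ih ⊢
    rcases h2 with h2 | h2 <;> simp [h2] <;> omega

/-- The histories that arise by pulling arms, with rewards read off from the table `x`. -/
inductive Reachable : History → Prop
  | nil : Reachable []
  | pull (k : Fin 2) {h : History} (hh : Reachable h) : Reachable (pull x k h)

theorem Reachable.iterate_pull {x} (k : Fin 2) (n : ℕ) {h : History} (hh : Reachable x h) :
    Reachable x ((DETC.pull x k)^[n] h) := by
  induction n with
  | zero => exact hh
  | succ n ih => rw [Function.iterate_succ_apply']; exact ih.pull k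

theorem reachable_pairHistory (n : ℕ) : Reachable x (pairHistory x n) := by
  induction n with
  | zero => exact .nil
  | succ n ih => rw [pairHistory_succ]; exact (ih.pull 0).pull 1

theorem Reachable.take {x} {h : History} (hh : Reachable x h) (n : ℕ) :
    Reachable x (h.take n) := by
  induction hh with
  | nil => simpa using Reachable.nil
  | @pull k h hh ih =>
    rcases le_or_gt n h.length with hn | hn
    · rw [DETC.pull, List.take_append_of_le_length hn]; exact ih
    · rw [List.take_of_length_le (by rw [length_pull]; omega)]; exact hh.pull k

/-- The average of the rewards number `s + 1, …, s + m` of arm `k`. -/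
def blockAvg (k : Fin 2) (s m : ℕ) : ℝ := (∑ i ∈ Finset.range m, x k (s + i)) / m

theorem Reachable.sum_arm {x} {h : History} (hh : Reachable x h) (k : Fin 2) :
    (h.map (fun p => if p.1 = k then p.2 else 0)).sum = ∑ n ∈ Finset.range (pulls k h), x k n := by
  induction hh with
  | nil => simp [pulls]
  | @pull k' h hh ih =>
    rw [pulls_pull, DETC.pull, List.map_append, List.sum_append, ih]
    by_cases hk : k' = k
    · subst hk; simp [Finset.sum_range_succ]
    · simp [hk]

theorem Reachable.avg_eq {x} {h : History} (hh : Reachable x h) (k : Fin 2) :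
    avg k h = blockAvg x k 0 (pulls k h) := by
  rw [avg, hh.sum_arm, blockAvg]; simp

theorem Reachable.sum_rewards {x} {h : History} (hh : Reachable x h) :
    (h.map Prod.snd).sum = ∑ k, ∑ n ∈ Finset.range (pulls k h), x k n := by
  rw [Fin.sum_univ_two, ← hh.sum_arm, ← hh.sum_arm, ← List.sum_map_add]
  congr 2
  funext p
  have h2 : p.1 = 0 ∨ p.1 = 1 := by omega
  rcases h2 with h2 | h2 <;> simp [h2]

end Histories

/-! ### The run in closed form -/

/-- The threshold of Stage I after `s` pulls of each arm. -/
def radiusI (T₁ : ℝ) (s : ℕ) : ℝ :=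
  √(16 / ((2 * s : ℕ) : ℝ) * logPlus (T₁ / ((2 * s : ℕ) : ℝ)))

/-- The threshold of Stage III after `m` pulls in that stage. -/
def radiusIII (T m : ℕ) : ℝ :=
  √(2 / m * Real.log (T / m * (Real.log (T / m) ^ 2 + 1)))

/-- The number of pulls of each arm at the end of Stage I. -/
def pairCount (T₁ : ℝ) (x : Fin 2 → ℕ → ℝ) : ℕ :=
  sInf {n : ℕ | radiusI T₁ (n + 1) ≤ |blockAvg x 0 0 (n + 1) - blockAvg x 1 0 (n + 1)|} + 1

/-- The arm `1'` with the larger average at the end of Stage I. -/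
def leader (tie : Fin 2) (T₁ : ℝ) (x : Fin 2 → ℕ → ℝ) : Fin 2 :=
  if blockAvg x 1 0 (pairCount T₁ x) < blockAvg x 0 0 (pairCount T₁ x) then 0
  else if blockAvg x 0 0 (pairCount T₁ x) < blockAvg x 1 0 (pairCount T₁ x) then 1 else tie

/-- The number of pulls of the leader at the end of Stage II. -/
def commitCount (T₁ : ℝ) : ℕ := ⌊T₁⌋₊ + 1

/-- The number of pulls in Stage III. -/
def testLength (tie : Fin 2) (T : ℕ) (T₁ : ℝ) (x : Fin 2 → ℕ → ℝ) : ℕ :=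
  sInf {n : ℕ | radiusIII T (n + 1) ≤ |blockAvg x (leader tie T₁ x) 0 (commitCount T₁) -
    blockAvg x (1 - leader tie T₁ x) (pairCount T₁ x) (n + 1)|} + 1

/-- The arm pulled in Stage IV. -/
def winner (tie : Fin 2) (T : ℕ) (T₁ : ℝ) (x : Fin 2 → ℕ → ℝ) : Fin 2 :=
  if blockAvg x (1 - leader tie T₁ x) (pairCount T₁ x) (testLength tie T T₁ x) ≤
    blockAvg x (leader tie T₁ x) 0 (commitCount T₁) then leader tie T₁ x else 1 - leader tie T₁ x

/-- The history of a run in which each arm is pulled `s` times in Stage I, arm `i` is pulled until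
it has `N` pulls, then the other arm `m` times, and then arm `a` until time `T + 1`. -/
def schedule (T N s : ℕ) (i : Fin 2) (m : ℕ) (a : Fin 2) (x : Fin 2 → ℕ → ℝ) : History :=
  (pull x a)^[T + 1 - (s + N + m)] ((pull x (1 - i))^[m] ((pull x i)^[N - s] (pairHistory x s)))

theorem radiusI_eq_zero {T₁ : ℝ} (h₀ : 0 ≤ T₁) {s : ℕ} (hs : T₁ ≤ 2 * s) : radiusI T₁ s = 0 := by
  have : logPlus (T₁ / ((2 * s : ℕ) : ℝ)) = 0 := by
    rw [logPlus, max_eq_left]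
    apply Real.log_nonpos (by positivity)
    push_cast
    exact div_le_one_of_le₀ hs (by positivity)
  rw [radiusI, this]; simp

theorem radiusIII_self {T : ℕ} (hT : 1 ≤ T) : radiusIII T T = 0 := by
  have : (T : ℝ) / T = 1 := div_self (by positivity)
  rw [radiusIII, this]; simp

section Run

variable (x : Fin 2 → ℕ → ℝ)

theorem iterate_pair_init (n : ℕ) :
    (fun h => pull x 1 (pull x 0 h))^[n] (init x) = pairHistory x (n + 1) :=
  (Function.iterate_succ_apply _ _ _).symm

theorem stageI_cond_iff (T₁ : ℝ) (s : ℕ) :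
    (|avg 0 (pairHistory x s) - avg 1 (pairHistory x s)| <
      √(16 / time (pairHistory x s) * logPlus (T₁ / time (pairHistory x s)))) ↔
    |blockAvg x 0 0 s - blockAvg x 1 0 s| < radiusI T₁ s := by
  rw [(reachable_pairHistory x s).avg_eq, (reachable_pairHistory x s).avg_eq,
    pulls_pairHistory, pulls_pairHistory, time, length_pairHistory, radiusI]

theorem exists_stageI_stop {T₁ : ℝ} (h₀ : 0 ≤ T₁) :
    ∃ n : ℕ, n ≤ ⌊T₁⌋₊ ∧
      radiusI T₁ (n + 1) ≤ |blockAvg x 0 0 (n + 1) - blockAvg x 1 0 (n + 1)| := by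
  refine ⟨⌊T₁⌋₊, le_rfl, ?_⟩
  rw [radiusI_eq_zero h₀]
  · exact abs_nonneg _
  · have := Nat.lt_floor_add_one T₁
    push_cast
    linarith [Nat.cast_nonneg (α := ℝ) ⌊T₁⌋₊]

theorem pairCount_pos (T₁ : ℝ) : 1 ≤ pairCount T₁ x := Nat.le_add_left _ _

theorem pairCount_le {T₁ : ℝ} (h₀ : 0 ≤ T₁) : pairCount T₁ x ≤ commitCount T₁ := by
  obtain ⟨n, hn, h⟩ := exists_stageI_stop x h₀
  exact Nat.succ_le_succ ((Nat.sInf_le h).trans hn)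

theorem radiusI_le_of_pairCount {T₁ : ℝ} (h₀ : 0 ≤ T₁) :
    radiusI T₁ (pairCount T₁ x) ≤
      |blockAvg x 0 0 (pairCount T₁ x) - blockAvg x 1 0 (pairCount T₁ x)| := by
  obtain ⟨n, -, h⟩ := exists_stageI_stop x h₀
  exact Nat.sInf_mem (s := {n : ℕ | radiusI T₁ (n + 1) ≤
    |blockAvg x 0 0 (n + 1) - blockAvg x 1 0 (n + 1)|}) ⟨n, h⟩

theorem lt_radiusI_of_lt_pairCount {T₁ : ℝ} {s : ℕ} (hs : 1 ≤ s) (h : s < pairCount T₁ x) :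
    |blockAvg x 0 0 s - blockAvg x 1 0 s| < radiusI T₁ s := by
  obtain ⟨n, rfl⟩ := Nat.exists_eq_add_of_le' hs
  exact not_le.1 (Nat.notMem_of_lt_sInf (Nat.lt_of_succ_lt_succ h))

theorem stageI_init {T₁ : ℝ} (h₀ : 0 ≤ T₁) :
    stageI x T₁ (init x) = pairHistory x (pairCount T₁ x) := by
  rw [pairCount, ← iterate_pair_init]
  apply whileLoop_eq_iterate
  · intro k hk
    simp only [iterate_pair_init, stageI_cond_iff]
    exact lt_radiusI_of_lt_pairCount x (Nat.le_add_left _ _) (Nat.succ_lt_succ hk)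
  · simp only [iterate_pair_init, stageI_cond_iff, not_lt]
    exact radiusI_le_of_pairCount x h₀

theorem bestArm_pairHistory (tie : Fin 2) (T₁ : ℝ) :
    bestArm tie (pairHistory x (pairCount T₁ x)) = leader tie T₁ x := by
  rw [bestArm, leader, (reachable_pairHistory x _).avg_eq, (reachable_pairHistory x _).avg_eq,
    pulls_pairHistory, pulls_pairHistory]

theorem blockAvg_le_leader (tie : Fin 2) (T₁ : ℝ) :
    blockAvg x (1 - leader tie T₁ x) 0 (pairCount T₁ x) ≤
      blockAvg x (leader tie T₁ x) 0 (pairCount T₁ x) := by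
  rw [leader]
  split_ifs with h1 h2
  · exact h1.le
  · exact h2.le
  · have := le_antisymm (not_lt.1 h1) (not_lt.1 h2)
    have h2 : tie = 0 ∨ tie = 1 := by omega
    rcases h2 with h2 | h2 <;> simp [h2, this]

theorem stageII_eq {T₁ : ℝ} (h₀ : 0 ≤ T₁) (i : Fin 2) {h : History}
    (hh : pulls i h ≤ commitCount T₁) :
    stageII x T₁ i h = (pull x i)^[commitCount T₁ - pulls i h] h := by
  apply whileLoop_eq_iterate
  · intro k hk
    rw [pulls_iterate_pull, if_pos rfl]
    apply (Nat.le_floor_iff h₀).1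
    rw [commitCount] at hk; omega
  · rw [pulls_iterate_pull, if_pos rfl, ← Nat.le_floor_iff h₀]
    rw [commitCount] at hh ⊢; omega

/-- The recursion for `θ` computes the average of the block of rewards that starts with the first
pull of Stage III; the junk value `0 / 0 = 0` agrees with the initial `θ = 0`. -/
theorem iterate_stepIII (j : Fin 2) (h : History) (n : ℕ) :
    (stepIII x j)^[n] ⟨h, 0, 0⟩ = ⟨(pull x j)^[n] h, n, blockAvg x j (pulls j h) n⟩ := by
  induction n with
  | zero => simp [blockAvg]
  | succ n ih =>
    rw [Function.iterate_succ_apply', ih, stepIII, Function.iterate_succ_apply']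
    congr 1
    simp only [blockAvg, pulls_iterate_pull, if_true, Finset.sum_range_succ]
    rcases Nat.eq_zero_or_pos n with rfl | hn
    · simp
    · field_simp
      push_cast
      ring

theorem iterate_stepIII_succ (j : Fin 2) (h : History) (n : ℕ) :
    (stepIII x j)^[n] (stepIII x j ⟨h, 0, 0⟩) =
      ⟨(pull x j)^[n + 1] h, n + 1, blockAvg x j (pulls j h) (n + 1)⟩ := by
  rw [← iterate_stepIII, Function.iterate_succ_apply]

theorem exists_stageIII_stop {T : ℕ} (hT : 1 ≤ T) (c : ℝ) (u : ℕ → ℝ) :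
    ∃ n : ℕ, n ≤ T - 1 ∧ radiusIII T (n + 1) ≤ |c - u (n + 1)| := by
  refine ⟨T - 1, le_rfl, ?_⟩
  rw [Nat.sub_add_cancel hT, radiusIII_self hT]
  exact abs_nonneg _

section Test

variable (tie : Fin 2) {T : ℕ} (T₁ : ℝ)

theorem testLength_pos : 1 ≤ testLength tie T T₁ x := Nat.le_add_left _ _

theorem testLength_le (hT : 1 ≤ T) : testLength tie T T₁ x ≤ T := by
  obtain ⟨n, hn, h⟩ := exists_stageIII_stop hT (blockAvg x (leader tie T₁ x) 0 (commitCount T₁))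
    (blockAvg x (1 - leader tie T₁ x) (pairCount T₁ x))
  have hle : testLength tie T T₁ x ≤ n + 1 := Nat.succ_le_succ (Nat.sInf_le h)
  omega

theorem radiusIII_le_of_testLength (hT : 1 ≤ T) :
    radiusIII T (testLength tie T T₁ x) ≤ |blockAvg x (leader tie T₁ x) 0 (commitCount T₁) -
      blockAvg x (1 - leader tie T₁ x) (pairCount T₁ x) (testLength tie T T₁ x)| := by
  obtain ⟨n, -, h⟩ := exists_stageIII_stop hT (blockAvg x (leader tie T₁ x) 0 (commitCount T₁))
    (blockAvg x (1 - leader tie T₁ x) (pairCount T₁ x))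
  exact Nat.sInf_mem (s := {n : ℕ | radiusIII T (n + 1) ≤
    |blockAvg x (leader tie T₁ x) 0 (commitCount T₁) -
    blockAvg x (1 - leader tie T₁ x) (pairCount T₁ x) (n + 1)|}) ⟨n, h⟩

theorem lt_radiusIII_of_lt_testLength {m : ℕ} (hm : 1 ≤ m) (h : m < testLength tie T T₁ x) :
    |blockAvg x (leader tie T₁ x) 0 (commitCount T₁) -
      blockAvg x (1 - leader tie T₁ x) (pairCount T₁ x) m| < radiusIII T m := by
  obtain ⟨n, rfl⟩ := Nat.exists_eq_add_of_le' hm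
  exact not_le.1 (Nat.notMem_of_lt_sInf (Nat.lt_of_succ_lt_succ h))

theorem one_sub_ne (i : Fin 2) : 1 - i ≠ i := by omega

theorem stageIV_eq (a : Fin 2) (h : History) :
    stageIV x T a h = (pull x a)^[T + 1 - h.length] h := by
  apply whileLoop_eq_iterate
  · intro k hk
    rw [time, length_iterate_pull]; omega
  · rw [time, length_iterate_pull]; omega

/-- The closed form of a run. By the end of Stage II the leader always has exactly `commitCount T₁`
pulls, because Stage I cannot pull an arm more often. -/
theorem run_eq_schedule (hT : 1 ≤ T) {T₁ : ℝ} (h₀ : 0 ≤ T₁) :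
    run tie T T₁ x = schedule T (commitCount T₁) (pairCount T₁ x) (leader tie T₁ x)
      (testLength tie T T₁ x) (winner tie T T₁ x) x := by
  have hle := pairCount_le x h₀
  have hII : stageII x T₁ (leader tie T₁ x) (pairHistory x (pairCount T₁ x)) =
      (pull x (leader tie T₁ x))^[commitCount T₁ - pairCount T₁ x]
        (pairHistory x (pairCount T₁ x)) := by
    rw [stageII_eq x h₀ _ (by rwa [pulls_pairHistory]), pulls_pairHistory]
  set h₂ := (pull x (leader tie T₁ x))^[commitCount T₁ - pairCount T₁ x]
        (pairHistory x (pairCount T₁ x)) with hh₂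
  have hr₂ : Reachable x h₂ := (reachable_pairHistory x _).iterate_pull _ _
  have hpi : pulls (leader tie T₁ x) h₂ = commitCount T₁ := by
    rw [hh₂, pulls_iterate_pull, if_pos rfl, pulls_pairHistory]; omega
  have hpj : pulls (1 - leader tie T₁ x) h₂ = pairCount T₁ x := by
    rw [hh₂, pulls_iterate_pull, if_neg (one_sub_ne _).symm, pulls_pairHistory, add_zero]
  have hlen : h₂.length = pairCount T₁ x + commitCount T₁ := by
    rw [hh₂, length_iterate_pull, length_pairHistory]; omega
  have hIII : stageIII x T (1 - leader tie T₁ x) (avg (leader tie T₁ x) h₂) h₂ =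
      ⟨(pull x (1 - leader tie T₁ x))^[testLength tie T T₁ x] h₂, testLength tie T T₁ x,
        blockAvg x (1 - leader tie T₁ x) (pairCount T₁ x) (testLength tie T T₁ x)⟩ := by
    rw [hr₂.avg_eq, hpi, testLength, ← hpj, ← iterate_stepIII_succ]
    apply whileLoop_eq_iterate
    · intro k hk
      simp only [iterate_stepIII_succ, hpj]
      exact lt_radiusIII_of_lt_testLength x tie T₁ (Nat.le_add_left _ _)
        (Nat.succ_lt_succ (by rwa [hpj] at hk))
    · simp only [iterate_stepIII_succ, hpj, not_lt]
      exact radiusIII_le_of_testLength x tie T₁ hT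
  rw [run]
  simp only [stageI_init x h₀, bestArm_pairHistory, hII, hIII]
  have havg : avg (leader tie T₁ x) ((pull x (1 - leader tie T₁ x))^[testLength tie T T₁ x] h₂) =
      blockAvg x (leader tie T₁ x) 0 (commitCount T₁) := by
    rw [(hr₂.iterate_pull _ _).avg_eq, pulls_iterate_pull, if_neg (one_sub_ne _), hpi, add_zero]
  rw [havg, stageIV_eq, length_iterate_pull, hlen, schedule, winner]

/-- The number of pulls of arm `k` in the first `T` time steps. -/
def armCount (tie : Fin 2) (T : ℕ) (T₁ : ℝ) (k : Fin 2) (x : Fin 2 → ℕ → ℝ) : ℕ :=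
  pulls k ((run tie T T₁ x).take T)

theorem reachable_run (hT : 1 ≤ T) {T₁ : ℝ} (h₀ : 0 ≤ T₁) : Reachable x (run tie T T₁ x) := by
  rw [run_eq_schedule x tie hT h₀]
  exact (((reachable_pairHistory x _).iterate_pull _ _).iterate_pull _ _).iterate_pull _ _

theorem totalReward_eq (hT : 1 ≤ T) {T₁ : ℝ} (h₀ : 0 ≤ T₁) :
    totalReward tie T T₁ x = ∑ k, ∑ n ∈ Finset.range (armCount tie T T₁ k x), x k n :=
  ((reachable_run x tie hT h₀).take T).sum_rewards

theorem length_schedule_ge (N s : ℕ) (hs : s ≤ N) (i : Fin 2) (m : ℕ) (a : Fin 2) :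
    T ≤ (schedule T N s i m a x).length := by
  rw [schedule, length_iterate_pull, length_iterate_pull, length_iterate_pull, length_pairHistory]
  omega

theorem armCount_add (hT : 1 ≤ T) {T₁ : ℝ} (h₀ : 0 ≤ T₁) :
    armCount tie T T₁ 0 x + armCount tie T T₁ 1 x = T := by
  rw [armCount, armCount, pulls_add_pulls, List.length_take, run_eq_schedule x tie hT h₀,
    min_eq_left (length_schedule_ge _ _ _ (pairCount_le x h₀) _ _ _)]

theorem armCount_le_horizon (k : Fin 2) : armCount tie T T₁ k x ≤ T :=
  (pulls_le_length _ _).trans (List.length_take_le _ _)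

theorem armCount_le (hT : 1 ≤ T) {T₁ : ℝ} (h₀ : 0 ≤ T₁) (k : Fin 2) :
    armCount tie T T₁ k x ≤ pairCount T₁ x + (if leader tie T₁ x = k then commitCount T₁ else 0) +
      (if 1 - leader tie T₁ x = k then testLength tie T T₁ x else 0) +
      (if winner tie T T₁ x = k then T else 0) := by
  by_cases ha : winner tie T T₁ x = k
  · rw [if_pos ha]; exact (armCount_le_horizon x tie T₁ k).trans (Nat.le_add_left _ _)
  · refine (pulls_mono_prefix k (List.take_prefix _ _)).trans ?_
    rw [run_eq_schedule x tie hT h₀, schedule, pulls_iterate_pull, pulls_iterate_pull,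
      pulls_iterate_pull, pulls_pairHistory, if_neg ha, if_neg ha]
    split_ifs <;> omega

/-- If Stage III pulls its arm at least `M` times, then the first `M` of these pulls happen before
the horizon, since the earlier stages take at most `2 * commitCount T₁` steps. -/
theorem le_armCount (hT : 1 ≤ T) {T₁ : ℝ} (h₀ : 0 ≤ T₁) {M : ℕ} (hM : M ≤ testLength tie T T₁ x)
    (hMT : 2 * commitCount T₁ + M ≤ T) : M ≤ armCount tie T T₁ (1 - leader tie T₁ x) x := by
  have hle := pairCount_le x h₀
  set q := (pull x (1 - leader tie T₁ x))^[M] ((pull x (leader tie T₁ x))^[commitCount T₁ -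
    pairCount T₁ x] (pairHistory x (pairCount T₁ x))) with hq
  have hpre : q <+: (run tie T T₁ x).take T := by
    rw [List.prefix_take_iff]
    constructor
    · rw [run_eq_schedule x tie hT h₀, schedule]
      refine List.IsPrefix.trans ?_ (prefix_iterate_pull _ _ _ _)
      obtain ⟨d, hd⟩ := Nat.exists_eq_add_of_le' hM
      rw [hd, Function.iterate_add_apply]
      exact prefix_iterate_pull _ _ _ _
    · rw [hq, length_iterate_pull, length_iterate_pull, length_pairHistory]; omega
  refine le_trans ?_ (pulls_mono_prefix _ hpre)
  rw [hq, pulls_iterate_pull, if_pos rfl]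
  exact Nat.le_add_left _ _

end Test
end Run

/-! ### The algorithm does not anticipate rewards -/

section Nonanticipation

variable {x y : Fin 2 → ℕ → ℝ} {k : Fin 2} {n : ℕ}

/-- The histories `h`, `h'` share a common part that contains `n` pulls of arm `k` and then both
continue with pull number `n + 1` of arm `k`, observing `x k n` and `y k n` respectively. -/
def Diverged (x y : Fin 2 → ℕ → ℝ) (k : Fin 2) (n : ℕ) (h h' : History) : Prop :=
  ∃ p : History, pulls k p = n ∧ p ++ [(k, x k n)] <+: h ∧ p ++ [(k, y k n)] <+: h'

/-- The histories coincide and contain at most `n` pulls of arm `k`, or they have diverged at pull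
number `n + 1` of that arm. -/
def Coupled (x y : Fin 2 → ℕ → ℝ) (k : Fin 2) (n : ℕ) (h h' : History) : Prop :=
  (h = h' ∧ pulls k h' ≤ n) ∨ Diverged x y k n h h'

theorem Diverged.mono {h₁ h₁' h₂ h₂' : History} (h : Diverged x y k n h₁ h₁') (h₁₂ : h₁ <+: h₂)
    (h₁₂' : h₁' <+: h₂') : Diverged x y k n h₂ h₂' := by
  obtain ⟨p, hp, hx, hy⟩ := h
  exact ⟨p, hp, hx.trans h₁₂, hy.trans h₁₂'⟩

/-- Starting from a common history, pulling arm `j` on two tables that differ only in the entry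
`(k, n)` either reads that entry and diverges, or gives the same history. -/
theorem coupled_pull (hxy : ∀ k' n', (k', n') ≠ (k, n) → x k' n' = y k' n') (j : Fin 2)
    {h : History} (hh : pulls k h ≤ n) : (j = k ∧ pulls j h = n ∧
      Diverged x y k n (pull x j h) (pull y j h)) ∨
    (x j (pulls j h) = y j (pulls j h) ∧ pull x j h = pull y j h ∧ pulls k (pull y j h) ≤ n) := by
  by_cases hc : j = k ∧ pulls j h = n
  · obtain ⟨rfl, hn⟩ := hc
    refine Or.inl ⟨rfl, hn, h, hn, ?_, ?_⟩ <;> rw [← hn] <;> exact List.prefix_rfl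
  · have e : x j (pulls j h) = y j (pulls j h) := hxy _ _ (by simpa using hc)
    refine Or.inr ⟨e, by rw [pull, pull, e], ?_⟩
    rw [pulls_pull]
    split_ifs with hj
    · subst hj
      have : pulls j h ≠ n := fun h => hc ⟨rfl, h⟩
      omega
    · exact hh

theorem Coupled.pull_both (hxy : ∀ k' n', (k', n') ≠ (k, n) → x k' n' = y k' n') (j : Fin 2)
    {h h' : History} (hh : Coupled x y k n h h') :
    Coupled x y k n (pull x j h) (pull y j h') := by
  rcases hh with ⟨rfl, hU⟩ | hD
  · rcases coupled_pull hxy j hU with ⟨-, -, h⟩ | ⟨-, h⟩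
    · exact Or.inr h
    · exact Or.inl h
  · exact Or.inr (hD.mono (prefix_pull x j _) (prefix_pull y j _))

theorem prefix_whileLoop {σ : Type} {cond : σ → Prop} {body : σ → σ} (f : σ → History)
    (hb : ∀ s, f s <+: f (body s)) (s : σ) : f s <+: f (whileLoop cond body s) := by
  rw [whileLoop]
  generalize sInf {n : ℕ | ¬ cond (body^[n] s)} = n
  induction n with
  | zero => exact List.prefix_rfl
  | succ n ih => rw [Function.iterate_succ_apply']; exact ih.trans (hb _)

theorem coupled_stageI (hxy : ∀ k' n', (k', n') ≠ (k, n) → x k' n' = y k' n') {T₁ : ℝ}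
    (h₀ : 0 ≤ T₁) : Coupled x y k n (stageI x T₁ (init x)) (stageI y T₁ (init y)) := by
  have hinit : Coupled x y k n (init x) (init y) :=
    (Coupled.pull_both hxy 0 (Or.inl ⟨rfl, Nat.zero_le _⟩)).pull_both hxy 1
  have hext : ∀ (z : Fin 2 → ℕ → ℝ) h, h <+: pull z 1 (pull z 0 h) :=
    fun z h => (prefix_pull z 0 h).trans (prefix_pull z 1 _)
  have hhalt : ∀ z : Fin 2 → ℕ → ℝ, ∃ m, ¬ (fun h => |avg 0 h - avg 1 h| <
      √(16 / time h * logPlus (T₁ / time h))) ((fun h => pull z 1 (pull z 0 h))^[m] (init z)) := by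
    intro z
    obtain ⟨m, -, hm⟩ := exists_stageI_stop z h₀
    refine ⟨m, ?_⟩
    simp only [iterate_pair_init, stageI_cond_iff, not_lt]
    exact hm
  rcases hinit with ⟨he, hU⟩ | hD
  · have hx := hhalt x
    rw [he] at hx
    rw [stageI, stageI, he]
    refine whileLoop_coupling (U := fun h => pulls k h ≤ n) (D := Diverged x y k n) ?_ ?_ ?_ hU hx
      (hhalt y)
    · intro h hh
      exact (Coupled.pull_both hxy 0 (Or.inl ⟨rfl, hh⟩)).pull_both hxy 1
    · exact fun h h' hD => hD.mono (hext x h) List.prefix_rfl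
    · exact fun h h' hD => hD.mono List.prefix_rfl (hext y h')
  · exact Or.inr (hD.mono (prefix_whileLoop id (hext x) _) (prefix_whileLoop id (hext y) _))

theorem coupled_whileLoop_pull (hxy : ∀ k' n', (k', n') ≠ (k, n) → x k' n' = y k' n')
    {cond : History → Prop} (j : Fin 2) (hhalt : ∀ (z : Fin 2 → ℕ → ℝ) h, ∃ m,
      ¬ cond ((pull z j)^[m] h)) {h : History} (hh : pulls k h ≤ n) :
    Coupled x y k n (whileLoop cond (pull x j) h) (whileLoop cond (pull y j) h) := by
  refine whileLoop_coupling (U := fun h => pulls k h ≤ n) (D := Diverged x y k n) ?_ ?_ ?_ hh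
    (hhalt x h) (hhalt y h)
  · intro h hh
    exact Coupled.pull_both hxy j (Or.inl ⟨rfl, hh⟩)
  · exact fun h h' hD => hD.mono (prefix_pull x j h) List.prefix_rfl
  · exact fun h h' hD => hD.mono List.prefix_rfl (prefix_pull y j h')

theorem exists_stageII_stop (T₁ : ℝ) (j : Fin 2) (z : Fin 2 → ℕ → ℝ) (h : History) :
    ∃ m, ¬ (pulls j ((pull z j)^[m] h) : ℝ) ≤ T₁ := by
  obtain ⟨m, hm⟩ := exists_nat_gt T₁
  refine ⟨m, not_le.2 (hm.trans_le ?_)⟩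
  rw [pulls_iterate_pull, if_pos rfl]
  exact_mod_cast Nat.le_add_left _ _

theorem exists_stageIV_stop (T : ℕ) (j : Fin 2) (z : Fin 2 → ℕ → ℝ) (h : History) :
    ∃ m, ¬ time ((pull z j)^[m] h) ≤ T :=
  ⟨T + 1, by rw [time, length_iterate_pull]; omega⟩

theorem coupled_stageIII (hxy : ∀ k' n', (k', n') ≠ (k, n) → x k' n' = y k' n') {T : ℕ}
    (hT : 1 ≤ T) (j : Fin 2) (μ' : ℝ) {h : History} (hh : pulls k h ≤ n) :
    (stageIII x T j μ' h = stageIII y T j μ' h ∧ pulls k (stageIII y T j μ' h).hist ≤ n) ∨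
      Diverged x y k n (stageIII x T j μ' h).hist (stageIII y T j μ' h).hist := by
  have hstep : ∀ s : StateIII, pulls k s.hist ≤ n →
      (stepIII x j s = stepIII y j s ∧ pulls k (stepIII y j s).hist ≤ n) ∨
        Diverged x y k n (stepIII x j s).hist (stepIII y j s).hist := by
    intro s hs
    rcases coupled_pull hxy j hs with ⟨-, -, hD⟩ | ⟨e, e', hU⟩
    · exact Or.inr hD
    · exact Or.inl ⟨by rw [stepIII, stepIII, e, e'], hU⟩
  have hext : ∀ (z : Fin 2 → ℕ → ℝ) (s : StateIII), s.hist <+: (stepIII z j s).hist :=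
    fun z s => prefix_pull z j s.hist
  have hhalt : ∀ z : Fin 2 → ℕ → ℝ, ∃ m, ¬ (fun s : StateIII => |μ' - s.θ| <
      √(2 / s.t₂ * Real.log (T / s.t₂ * (Real.log (T / s.t₂) ^ 2 + 1))))
        ((stepIII z j)^[m] (stepIII z j ⟨h, 0, 0⟩)) := by
    intro z
    obtain ⟨m, -, hm⟩ := exists_stageIII_stop hT μ' (blockAvg z j (pulls j h))
    refine ⟨m, ?_⟩
    simp only [iterate_stepIII_succ, not_lt]
    exact hm
  rw [stageIII, stageIII]
  rcases hstep ⟨h, 0, 0⟩ hh with ⟨he, hU⟩ | hD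
  · have hx := hhalt x
    rw [he] at hx ⊢
    refine whileLoop_coupling (U := fun s : StateIII => pulls k s.hist ≤ n)
      (D := fun s s' => Diverged x y k n s.hist s'.hist) hstep ?_ ?_ hU hx (hhalt y)
    · exact fun s s' hD => hD.mono (hext x s) List.prefix_rfl
    · exact fun s s' hD => hD.mono List.prefix_rfl (hext y s')
  · exact Or.inr (hD.mono (prefix_whileLoop StateIII.hist (hext x) _)
      (prefix_whileLoop StateIII.hist (hext y) _))

theorem coupled_run (hxy : ∀ k' n', (k', n') ≠ (k, n) → x k' n' = y k' n') (tie : Fin 2) {T : ℕ}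
    (hT : 1 ≤ T) {T₁ : ℝ} (h₀ : 0 ≤ T₁) : Coupled x y k n (run tie T T₁ x) (run tie T T₁ y) := by
  have hII : ∀ (z : Fin 2 → ℕ → ℝ) i h, h <+: stageII z T₁ i h :=
    fun z i h => prefix_whileLoop id (prefix_pull z i) h
  have hIII : ∀ (z : Fin 2 → ℕ → ℝ) j μ' h, h <+: (stageIII z T j μ' h).hist :=
    fun z j μ' h => (prefix_pull z j h).trans
      (prefix_whileLoop StateIII.hist (fun s => prefix_pull z j s.hist) (stepIII z j ⟨h, 0, 0⟩))
  have hIV : ∀ (z : Fin 2 → ℕ → ℝ) a h, h <+: stageIV z T a h :=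
    fun z a h => prefix_whileLoop id (prefix_pull z a) h
  simp only [run]
  rcases coupled_stageI hxy h₀ with ⟨he, hU⟩ | hD
  · rw [he]
    rcases coupled_whileLoop_pull hxy
      (cond := fun h => (pulls (bestArm tie (stageI y T₁ (init y))) h : ℝ) ≤ T₁) _
      (exists_stageII_stop T₁ _) hU with ⟨he₂, hU₂⟩ | hD
    · rw [← stageII, ← stageII] at he₂
      rw [← stageII] at hU₂
      rw [he₂]
      rcases coupled_stageIII hxy hT (1 - bestArm tie (stageI y T₁ (init y)))
        (avg (bestArm tie (stageI y T₁ (init y))) (stageII y T₁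
          (bestArm tie (stageI y T₁ (init y))) (stageI y T₁ (init y)))) hU₂ with ⟨he₃, hU₃⟩ | hD
      · rw [he₃]
        exact coupled_whileLoop_pull hxy (cond := fun h => time h ≤ T) _
          (exists_stageIV_stop T _) hU₃
      · exact Or.inr (hD.mono (hIV x _ _) (hIV y _ _))
    · rw [← stageII, ← stageII] at hD
      exact Or.inr (hD.mono ((hIII x _ _ _).trans (hIV x _ _)) ((hIII y _ _ _).trans (hIV y _ _)))
  · exact Or.inr (hD.mono (((hII x _ _).trans (hIII x _ _ _)).trans (hIV x _ _))
      (((hII y _ _).trans (hIII y _ _ _)).trans (hIV y _ _)))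

theorem lt_pulls_take_iff {h p : History} {r : ℝ} (hp : p ++ [(k, r)] <+: h) (T : ℕ) :
    pulls k p < pulls k (h.take T) ↔ p.length < T := by
  constructor
  · intro hlt
    by_contra hT
    have : h.take T <+: p := by
      rw [List.prefix_iff_eq_take.1 ((List.prefix_append _ _).trans hp : p <+: h)]
      exact List.take_prefix_take_left (not_lt.1 hT)
    exact absurd (pulls_mono_prefix k this) (not_le.2 hlt)
  · intro hlt
    have : p ++ [(k, r)] <+: h.take T := List.prefix_take_iff.2 ⟨hp, by simpa using hlt⟩
    refine lt_of_lt_of_le ?_ (pulls_mono_prefix k this)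
    simp [pulls, List.countP_append]

/-- Whether arm `k` is pulled more than `n` times up to time `T` does not depend on the reward of
pull number `n + 1` of this arm. -/
theorem lt_armCount_iff (hxy : ∀ k' n', (k', n') ≠ (k, n) → x k' n' = y k' n') (tie : Fin 2)
    {T : ℕ} (hT : 1 ≤ T) {T₁ : ℝ} (h₀ : 0 ≤ T₁) :
    n < armCount tie T T₁ k x ↔ n < armCount tie T T₁ k y := by
  rw [armCount, armCount]
  rcases coupled_run hxy tie hT h₀ with ⟨he, -⟩ | ⟨p, hp, hx, hy⟩
  · rw [he]
  · rw [← hp] at hx hy ⊢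
    rw [lt_pulls_take_iff hx, lt_pulls_take_iff hy]

end Nonanticipation

/-! ### Measurability of the number of pulls -/

section Measurability

theorem measurable_sInf_nat {α : Type*} [MeasurableSpace α] {p : α → ℕ → Prop}
    (hp : ∀ a, ∃ n, p a n) (hm : ∀ n, MeasurableSet {a | p a n}) :
    Measurable fun a => sInf {n | p a n} := by
  classical
  have : (fun a => sInf {n | p a n}) = fun a => Nat.find (hp a) := by
    funext a; exact Nat.sInf_def (hp a)
  rw [this]
  exact measurable_find hp hm

/-- A property may be checked for each value of a countable-valued random parameter separately. -/
theorem measurableSet_setOf_param {α β : Type*} [MeasurableSpace α] [MeasurableSpace β]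
    [Countable β] [MeasurableSingletonClass β] {f : α → β} (hf : Measurable f)
    {Q : β → α → Prop} (hQ : ∀ b, MeasurableSet {a | Q b a}) : MeasurableSet {a | Q (f a) a} := by
  have : {a | Q (f a) a} = ⋃ b, (f ⁻¹' {b} ∩ {a | Q b a}) := by
    ext a; simp
  rw [this]
  exact MeasurableSet.iUnion fun b => (hf (measurableSet_singleton b)).inter (hQ b)

theorem measurable_blockAvg (k : Fin 2) (s m : ℕ) :
    Measurable fun x : Fin 2 → ℕ → ℝ => blockAvg x k s m := by
  unfold blockAvg; fun_prop

theorem measurable_pairCount {T₁ : ℝ} (h₀ : 0 ≤ T₁) : Measurable (pairCount T₁) := by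
  refine (measurable_sInf_nat (fun x => ?_) fun n => ?_).add_const 1
  · obtain ⟨n, -, h⟩ := exists_stageI_stop x h₀
    exact ⟨n, h⟩
  · have h0 := measurable_blockAvg 0 0 (n + 1)
    have h1 := measurable_blockAvg 1 0 (n + 1)
    exact measurableSet_le measurable_const (continuous_abs.measurable.comp (h0.sub h1))

theorem measurable_leader (tie : Fin 2) {T₁ : ℝ} (h₀ : 0 ≤ T₁) : Measurable (leader tie T₁) := by
  have hlt : ∀ k k', MeasurableSet {x : Fin 2 → ℕ → ℝ |
      blockAvg x k 0 (pairCount T₁ x) < blockAvg x k' 0 (pairCount T₁ x)} := fun k k' =>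
    measurableSet_setOf_param (Q := fun s x => blockAvg x k 0 s < blockAvg x k' 0 s)
      (measurable_pairCount h₀)
      fun s => measurableSet_lt (measurable_blockAvg k 0 s) (measurable_blockAvg k' 0 s)
  exact Measurable.ite (hlt 1 0) measurable_const (Measurable.ite (hlt 0 1) measurable_const
    measurable_const)

theorem measurable_testLength (tie : Fin 2) {T : ℕ} (hT : 1 ≤ T) {T₁ : ℝ} (h₀ : 0 ≤ T₁) :
    Measurable (testLength tie T T₁) := by
  refine (measurable_sInf_nat (fun x => ?_) fun n => ?_).add_const 1
  · obtain ⟨n, -, h⟩ := exists_stageIII_stop hT (blockAvg x (leader tie T₁ x) 0 (commitCount T₁))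
      (blockAvg x (1 - leader tie T₁ x) (pairCount T₁ x))
    exact ⟨n, h⟩
  · refine measurableSet_setOf_param (Q := fun (q : ℕ × Fin 2) x => radiusIII T (n + 1) ≤
      |blockAvg x q.2 0 (commitCount T₁) - blockAvg x (1 - q.2) q.1 (n + 1)|)
      ((measurable_pairCount h₀).prodMk (measurable_leader tie h₀)) fun q => ?_
    have h0 := measurable_blockAvg q.2 0 (commitCount T₁)
    have h1 := measurable_blockAvg (1 - q.2) q.1 (n + 1)
    exact measurableSet_le measurable_const (continuous_abs.measurable.comp (h0.sub h1))

theorem measurable_winner (tie : Fin 2) {T : ℕ} (hT : 1 ≤ T) {T₁ : ℝ} (h₀ : 0 ≤ T₁) :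
    Measurable (winner tie T T₁) := by
  have hl := measurable_leader tie h₀
  refine Measurable.ite ?_ hl ((measurable_from_top (f := fun i : Fin 2 => 1 - i)).comp hl)
  exact measurableSet_setOf_param (Q := fun (q : (ℕ × Fin 2) × ℕ) x =>
    blockAvg x (1 - q.1.2) q.1.1 q.2 ≤ blockAvg x q.1.2 0 (commitCount T₁))
    (((measurable_pairCount h₀).prodMk hl).prodMk (measurable_testLength tie hT h₀))
    fun q => measurableSet_le (measurable_blockAvg _ _ _) (measurable_blockAvg _ _ _)

theorem map_fst_iterate_congr {f g : History → History} (hfg : ∀ h h' : History,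
    h.map Prod.fst = h'.map Prod.fst → (f h).map Prod.fst = (g h').map Prod.fst) (n : ℕ)
    {h h' : History} (hh : h.map Prod.fst = h'.map Prod.fst) :
    (f^[n] h).map Prod.fst = (g^[n] h').map Prod.fst := by
  induction n with
  | zero => exact hh
  | succ n ih => rw [Function.iterate_succ_apply', Function.iterate_succ_apply']; exact hfg _ _ ih

theorem map_fst_schedule (T N s : ℕ) (i : Fin 2) (m : ℕ) (a : Fin 2) (x y : Fin 2 → ℕ → ℝ) :
    (schedule T N s i m a x).map Prod.fst = (schedule T N s i m a y).map Prod.fst := by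
  have hpull : ∀ (k : Fin 2) (h h' : History), h.map Prod.fst = h'.map Prod.fst →
      (pull x k h).map Prod.fst = (pull y k h').map Prod.fst := by
    intro k h h' hh
    rw [pull, pull, List.map_append, List.map_append, hh]; rfl
  exact map_fst_iterate_congr (hpull a) _ (map_fst_iterate_congr (hpull _) _
    (map_fst_iterate_congr (hpull i) _ (map_fst_iterate_congr
      (fun h h' hh => hpull 1 _ _ (hpull 0 _ _ hh)) _ rfl)))

theorem pulls_eq_map_fst (k : Fin 2) (h : History) :
    pulls k h = (h.map Prod.fst).countP (fun j => j = k) := by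
  rw [List.countP_map]; rfl

theorem measurable_armCount (tie : Fin 2) {T : ℕ} (hT : 1 ≤ T) {T₁ : ℝ} (h₀ : 0 ≤ T₁)
    (k : Fin 2) : Measurable (armCount tie T T₁ k) := by
  -- the sequence of arms depends on the reward table only through four discrete parameters
  have : armCount tie T T₁ k = (fun q : (ℕ × Fin 2) × (ℕ × Fin 2) => pulls k
      ((schedule T (commitCount T₁) q.1.1 q.1.2 q.2.1 q.2.2 0).take T)) ∘
      fun x => ((pairCount T₁ x, leader tie T₁ x), (testLength tie T T₁ x, winner tie T T₁ x)) := by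
    funext x
    rw [armCount, run_eq_schedule x tie hT h₀, Function.comp_apply, pulls_eq_map_fst,
      pulls_eq_map_fst, List.map_take, List.map_take, map_fst_schedule]
  rw [this]
  exact (measurable_of_countable _).comp
    (((measurable_pairCount h₀).prodMk (measurable_leader tie h₀)).prodMk
      ((measurable_testLength tie hT h₀).prodMk (measurable_winner tie hT h₀)))

end Measurability

/-! ### The regret in terms of the number of pulls of the worse arm -/

section Wald

variable {ν : Fin 2 → Measure ℝ} {Ω : Type*} [MeasurableSpace Ω] {P : Measure Ω}
  {X : Fin 2 → ℕ → Ω → ℝ}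

theorem IsRewardTable.measurable_table (hX : IsRewardTable P ν X) :
    Measurable fun ω => fun k n => X k n ω :=
  measurable_pi_lambda _ fun k => measurable_pi_lambda _ fun n => hX.measurable k n

theorem integrable_id_of_subgaussian [∀ k, IsProbabilityMeasure (ν k)]
    (hν : ∀ k, IsOneSubgaussian ν k) (k : Fin 2) : Integrable (fun y => y) (ν k) := by
  have := (hν k).integrable.add (integrable_const (mean ν k))
  exact this.congr (ae_of_all _ fun y => by simp)

theorem IsRewardTable.integrable [∀ k, IsProbabilityMeasure (ν k)]
    (hν : ∀ k, IsOneSubgaussian ν k) (hX : IsRewardTable P ν X) (k : Fin 2) (n : ℕ) :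
    Integrable (X k n) P := by
  have h := integrable_id_of_subgaussian hν k
  rw [← hX.law k n] at h
  exact h.comp_measurable (hX.measurable k n)

theorem IsRewardTable.integral_eq (hX : IsRewardTable P ν X) (k : Fin 2) (n : ℕ) :
    ∫ ω, X k n ω ∂P = mean ν k := by
  rw [mean, ← hX.law k n, integral_map (hX.measurable k n).aemeasurable]
  exact aestronglyMeasurable_id

/-- The event that arm `k` is pulled more than `n` times up to time `T` is independent of the
reward of pull number `n + 1`, because it can be read off from the other rewards. -/
theorem integral_indicator_mul_reward [IsProbabilityMeasure P] (hX : IsRewardTable P ν X)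
    (tie : Fin 2) {T : ℕ} (hT : 1 ≤ T) {T₁ : ℝ} (h₀ : 0 ≤ T₁) (k : Fin 2) (n : ℕ) :
    ∫ ω, {ω | n < armCount tie T T₁ k fun k n => X k n ω}.indicator (X k n) ω ∂P =
      P.real {ω | n < armCount tie T T₁ k fun k n => X k n ω} * mean ν k := by
  set A := {ω | n < armCount tie T T₁ k fun k n => X k n ω} with hA
  let Z : Fin 2 × ℕ → Ω → ℝ := fun p => X p.1 p.2
  let m : Fin 2 × ℕ → MeasurableSpace Ω := fun p => MeasurableSpace.comap (Z p) inferInstance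
  have hm : ∀ p, m p ≤ (inferInstance : MeasurableSpace Ω) :=
    fun p => (hX.measurable p.1 p.2).comap_le
  have hdisj : Disjoint ({(k, n)} : Set (Fin 2 × ℕ)) {(k, n)}ᶜ := disjoint_compl_right
  have hind := indep_iSup_of_disjoint hm hX.indep hdisj
  -- the table in which the reward of pull number `n + 1` of arm `k` is replaced by zero
  let Y : Ω → Fin 2 → ℕ → ℝ := fun ω k' n' => if (k', n') = (k, n) then 0 else X k' n' ω
  have hY : Measurable[⨆ p ∈ ({(k, n)} : Set (Fin 2 × ℕ))ᶜ, m p] Y := by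
    refine @measurable_pi_lambda _ _ _ (_) _ _ fun k' => ?_
    refine @measurable_pi_lambda _ _ _ (_) _ _ fun n' => ?_
    by_cases h : (k', n') = (k, n)
    · have : (fun ω => Y ω k' n') = fun _ => 0 := by funext ω; simp only [Y, if_pos h]
      rw [this]; exact measurable_const
    · have : (fun ω => Y ω k' n') = Z (k', n') := by funext ω; simp only [Y, if_neg h, Z]
      rw [this]
      exact (comap_measurable (Z (k', n'))).mono
        (le_iSup₂_of_le (f := fun p (_ : p ∈ ({(k, n)} : Set (Fin 2 × ℕ))ᶜ) => m p)
          (k', n') h le_rfl) le_rfl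
  have hAY : A = Y ⁻¹' {x | n < armCount tie T T₁ k x} := by
    ext ω
    refine lt_armCount_iff (fun k' n' h => ?_) tie hT h₀
    simp only [Y, if_neg h]
  have hAm : MeasurableSet[⨆ p ∈ ({(k, n)} : Set (Fin 2 × ℕ))ᶜ, m p] A := by
    rw [hAY]
    exact hY (measurableSet_lt measurable_const (measurable_armCount tie hT h₀ k))
  have hAm' : MeasurableSet A := (iSup₂_le fun p _ => hm p) _ hAm
  have hI : IndepFun (X k n) (A.indicator fun _ => (1 : ℝ)) P := by
    rw [IndepFun_iff_Indep]
    refine indep_of_indep_of_le_left (indep_of_indep_of_le_right hind ?_) ?_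
    · exact Measurable.comap_le (measurable_const.indicator hAm)
    · exact le_iSup₂_of_le (f := fun p (_ : p ∈ ({(k, n)} : Set (Fin 2 × ℕ))) => m p)
        (k, n) rfl le_rfl
  have hmul : A.indicator (X k n) = X k n * A.indicator fun _ => (1 : ℝ) := by
    funext ω; by_cases h : ω ∈ A <;> simp [h]
  rw [hmul, hI.integral_mul_eq_mul_integral (hX.measurable k n).aestronglyMeasurable
    (measurable_const.indicator hAm').aestronglyMeasurable, hX.integral_eq, mul_comm]
  congr 1
  exact integral_indicator_one hAm'

/-- **Wald's identity** for the rewards collected up to time `T`. -/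
theorem integral_totalReward [∀ k, IsProbabilityMeasure (ν k)] [IsProbabilityMeasure P]
    (hν : ∀ k, IsOneSubgaussian ν k) (hX : IsRewardTable P ν X)
    (tie : Fin 2) {T : ℕ} (hT : 1 ≤ T) {T₁ : ℝ} (h₀ : 0 ≤ T₁) :
    ∫ ω, totalReward tie T T₁ (fun k n => X k n ω) ∂P =
      ∑ k, mean ν k * ∫ ω, (armCount tie T T₁ k fun k n => X k n ω : ℝ) ∂P := by
  have hAm : ∀ k n, MeasurableSet {ω | n < armCount tie T T₁ k fun k n => X k n ω} := fun k n =>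
    measurableSet_lt measurable_const ((measurable_armCount tie hT h₀ k).comp hX.measurable_table)
  have hsum : ∀ (k : Fin 2) (f : ℕ → ℝ) (ω : Ω),
      ∑ n ∈ Finset.range (armCount tie T T₁ k fun k n => X k n ω), f n =
      ∑ n ∈ Finset.range T, if n < armCount tie T T₁ k fun k n => X k n ω then f n else 0 := by
    intro k f ω
    rw [← Finset.sum_filter]
    congr 1
    ext n
    have := armCount_le_horizon (fun k n => X k n ω) tie (T := T) T₁ k
    simp only [Finset.mem_range, Finset.mem_filter]
    omega
  have hint : ∀ k n, Integrable
      ({ω | n < armCount tie T T₁ k fun k n => X k n ω}.indicator (X k n)) P :=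
    fun k n => (hX.integrable hν k n).indicator (hAm k n)
  have h1 : ∀ ω, totalReward tie T T₁ (fun k n => X k n ω) = ∑ k, ∑ n ∈ Finset.range T,
      {ω | n < armCount tie T T₁ k fun k n => X k n ω}.indicator (X k n) ω := by
    intro ω
    rw [totalReward_eq _ tie hT h₀]
    refine Finset.sum_congr rfl fun k _ => ?_
    rw [hsum]
    exact Finset.sum_congr rfl fun n _ => by simp only [Set.indicator, Set.mem_ofPred_eq]; congr
  have h2 : ∀ k, ∫ ω, (armCount tie T T₁ k fun k n => X k n ω : ℝ) ∂P =
      ∑ n ∈ Finset.range T, P.real {ω | n < armCount tie T T₁ k fun k n => X k n ω} := by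
    intro k
    have : ∀ ω, (armCount tie T T₁ k fun k n => X k n ω : ℝ) = ∑ n ∈ Finset.range T,
        {ω | n < armCount tie T T₁ k fun k n => X k n ω}.indicator 1 ω := by
      intro ω
      have := hsum k (fun _ => 1) ω
      simp only [Finset.sum_const, Finset.card_range, nsmul_eq_mul, mul_one] at this
      rw [this]
      exact Finset.sum_congr rfl fun n _ => by
        simp only [Set.indicator, Set.mem_ofPred_eq, Pi.one_apply]
    simp only [this]
    rw [integral_finsetSum]
    · exact Finset.sum_congr rfl fun n _ => integral_indicator_one (hAm k n)
    · exact fun n _ => (integrable_const (1 : ℝ)).indicator (hAm k n)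
  simp only [h1]
  rw [integral_finsetSum _ fun k _ => integrable_finsetSum _ fun n _ => hint k n]
  refine Finset.sum_congr rfl fun k _ => ?_
  rw [integral_finsetSum _ fun n _ => hint k n, h2, Finset.mul_sum]
  exact Finset.sum_congr rfl fun n _ => by
    rw [integral_indicator_mul_reward hX tie hT h₀, mul_comm]

theorem integrable_armCount [IsProbabilityMeasure P] (hX : IsRewardTable P ν X)
    (tie : Fin 2) {T : ℕ} (hT : 1 ≤ T) {T₁ : ℝ} (h₀ : 0 ≤ T₁) (k : Fin 2) :
    Integrable (fun ω => (armCount tie T T₁ k fun k n => X k n ω : ℝ)) P := by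
  refine Integrable.of_bound (C := T) ?_ (ae_of_all _ fun ω => ?_)
  · exact ((measurable_from_top (f := fun n : ℕ => (n : ℝ))).comp
      ((measurable_armCount tie hT h₀ k).comp hX.measurable_table)).aestronglyMeasurable
  · rw [Real.norm_natCast]
    exact_mod_cast armCount_le_horizon _ tie T₁ k

/-- Only pulls of the worse arm `b` contribute to the regret. -/
theorem regret_eq [∀ k, IsProbabilityMeasure (ν k)] [IsProbabilityMeasure P]
    (hν : ∀ k, IsOneSubgaussian ν k) (hX : IsRewardTable P ν X)
    (tie : Fin 2) {T : ℕ} (hT : 1 ≤ T) {T₁ : ℝ} (h₀ : 0 ≤ T₁) {b : Fin 2} {Δ : ℝ} (hΔ : 0 ≤ Δ)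
    (hb : mean ν (1 - b) = mean ν b + Δ) :
    regret P ν X tie T T₁ = Δ * ∫ ω, (armCount tie T T₁ b fun k n => X k n ω : ℝ) ∂P := by
  have hadd : ∫ ω, (armCount tie T T₁ 0 fun k n => X k n ω : ℝ) ∂P +
      ∫ ω, (armCount tie T T₁ 1 fun k n => X k n ω : ℝ) ∂P = T := by
    rw [← integral_add (integrable_armCount hX tie hT h₀ 0) (integrable_armCount hX tie hT h₀ 1)]
    have : ∀ ω, (armCount tie T T₁ 0 fun k n => X k n ω : ℝ) +
        (armCount tie T T₁ 1 fun k n => X k n ω : ℝ) = T := fun ω => by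
      exact_mod_cast armCount_add (fun k n => X k n ω) tie hT h₀
    simp only [this]
    simp
  rw [regret, integral_totalReward hν hX tie hT h₀, Fin.sum_univ_two]
  have h2 : b = 0 ∨ b = 1 := by omega
  rcases h2 with rfl | rfl
  · rw [show (1 : Fin 2) - 0 = 1 from rfl] at hb
    rw [max_eq_right (by linarith), ← hadd, hb]; ring
  · rw [show (1 : Fin 2) - 1 = 0 from rfl] at hb
    rw [max_eq_left (by linarith), ← hadd, hb]; ring

end Wald

/-! ### Events that lead to a wrong decision or a long exploration -/

section Deterministic

variable {x : Fin 2 → ℕ → ℝ} {μ : Fin 2 → ℝ} {b : Fin 2} {Δ : ℝ} {tie : Fin 2} {T : ℕ} {T₁ : ℝ}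

/-- If the worse arm `b` leads after Stage I, the averages are in the wrong order and differ by at
least the threshold, so one of them deviates by half of `Δ` plus the threshold. -/
theorem exists_deviation_of_leader (h₀ : 0 ≤ T₁) (hb : μ (1 - b) = μ b + Δ)
    (hl : leader tie T₁ x = b) : ∃ s ∈ Finset.Icc 1 (commitCount T₁), ∃ k : Fin 2,
      (Δ + radiusI T₁ s) / 2 ≤ |blockAvg x k 0 s - μ k| := by
  refine ⟨pairCount T₁ x, Finset.mem_Icc.2 ⟨pairCount_pos x T₁, pairCount_le x h₀⟩, ?_⟩
  have h1 := blockAvg_le_leader x tie T₁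
  have h2 := radiusI_le_of_pairCount x h₀
  rw [hl] at h1
  have h3 : |blockAvg x 0 0 (pairCount T₁ x) - blockAvg x 1 0 (pairCount T₁ x)| =
      blockAvg x b 0 (pairCount T₁ x) - blockAvg x (1 - b) 0 (pairCount T₁ x) := by
    have h2 : b = 0 ∨ b = 1 := by omega
    rcases h2 with rfl | rfl
    · exact abs_of_nonneg (sub_nonneg.2 h1)
    · rw [abs_sub_comm]; exact abs_of_nonneg (sub_nonneg.2 h1)
  rw [h3] at h2
  by_contra! hc
  have ha := (abs_lt.1 (hc b)).2
  have hd := (abs_lt.1 (hc (1 - b))).1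
  linarith

theorem exists_deviation_of_lt_pairCount (hb : μ (1 - b) = μ b + Δ) {s : ℕ} (hs : 1 ≤ s)
    (hr : radiusI T₁ s ≤ Δ / 2) (h : s < pairCount T₁ x) :
    ∃ k : Fin 2, Δ / 4 ≤ |blockAvg x k 0 s - μ k| := by
  have h1 := (lt_radiusI_of_lt_pairCount x hs h).trans_le hr
  have h3 : blockAvg x (1 - b) 0 s - blockAvg x b 0 s < Δ / 2 := by
    have h2 : b = 0 ∨ b = 1 := by omega
    rcases h2 with rfl | rfl
    · have := (abs_lt.1 h1).1
      change blockAvg x 1 0 s - blockAvg x 0 0 s < Δ / 2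
      linarith
    · exact (abs_lt.1 h1).2
  by_contra! hc
  have ha := (abs_lt.1 (hc b)).2
  have hd := (abs_lt.1 (hc (1 - b))).1
  linarith

theorem exists_deviation_of_lt_testLength (h₀ : 0 ≤ T₁) (hb : μ (1 - b) = μ b + Δ)
    (hl : leader tie T₁ x = 1 - b) {ε : ℝ} {m : ℕ} (hm : 1 ≤ m) (hr : radiusIII T m ≤ Δ - 2 * ε)
    (h : m < testLength tie T T₁ x) :
    ε ≤ |blockAvg x (1 - b) 0 (commitCount T₁) - μ (1 - b)| ∨
      ∃ s ∈ Finset.Icc 1 (commitCount T₁), ε ≤ |blockAvg x b s m - μ b| := by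
  have h1 := (lt_radiusIII_of_lt_testLength x tie T₁ hm h).trans_le hr
  rw [hl, sub_sub_cancel] at h1
  have h2 := (abs_lt.1 h1).2
  by_contra! hc
  have ha := (abs_lt.1 (hc.2 _ (Finset.mem_Icc.2 ⟨pairCount_pos x T₁, pairCount_le x h₀⟩))).2
  have hd := (abs_lt.1 hc.1).1
  linarith

/-- If Stage IV repeats the worse arm, then either the average of the leader or a block average of
Stage III is off by `Δ / 2`, the latter by the threshold in addition. This holds for both possible
leaders. -/
theorem exists_deviation_of_winner (hT : 1 ≤ T) (h₀ : 0 ≤ T₁) (hb : μ (1 - b) = μ b + Δ)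
    (hw : winner tie T T₁ x = b) :
    (∃ k : Fin 2, Δ / 2 ≤ |blockAvg x k 0 (commitCount T₁) - μ k|) ∨
      ∃ k : Fin 2, ∃ s ∈ Finset.Icc 1 (commitCount T₁), ∃ m ∈ Finset.Icc 1 T,
        radiusIII T m + Δ / 2 ≤ |blockAvg x k s m - μ k| := by
  have hr := radiusIII_le_of_testLength x tie T₁ hT
  have hs : pairCount T₁ x ∈ Finset.Icc 1 (commitCount T₁) :=
    Finset.mem_Icc.2 ⟨pairCount_pos x T₁, pairCount_le x h₀⟩
  have hm : testLength tie T T₁ x ∈ Finset.Icc 1 T :=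
    Finset.mem_Icc.2 ⟨testLength_pos x tie T₁, testLength_le x tie T₁ hT⟩
  by_contra! hc
  have h0 := hc.1 (leader tie T₁ x)
  have h1 := hc.2 (1 - leader tie T₁ x) _ hs _ hm
  rw [abs_lt] at h0 h1
  rw [winner] at hw
  split_ifs at hw with hle
  · rw [abs_of_nonneg (sub_nonneg.2 hle)] at hr
    rw [hw] at h0 h1 hr
    linarith
  · rw [abs_of_neg (sub_neg.2 (not_le.1 hle))] at hr
    have hl : leader tie T₁ x = 1 - b := by rw [← hw, sub_sub_cancel]
    rw [hl] at h0 h1 hr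
    rw [sub_sub_cancel] at h1 hr
    linarith

theorem exists_deviation_of_testLength (hT : 1 ≤ T) (h₀ : 0 ≤ T₁) (hb : μ (1 - b) = μ b + Δ)
    (hΔ : 0 ≤ Δ) (hl : leader tie T₁ x = 1 - b) (ε : ℝ) :
    ε ≤ |blockAvg x (1 - b) 0 (commitCount T₁) - μ (1 - b)| ∨
      ∃ s ∈ Finset.Icc 1 (commitCount T₁), radiusIII T (testLength tie T T₁ x) - Δ - ε ≤
        |blockAvg x b s (testLength tie T T₁ x) - μ b| := by
  have hr := radiusIII_le_of_testLength x tie T₁ hT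
  rw [hl, sub_sub_cancel] at hr
  by_contra! hc
  have ha := hc.2 _ (Finset.mem_Icc.2 ⟨pairCount_pos x T₁, pairCount_le x h₀⟩)
  have hd := hc.1
  rw [abs_lt] at ha hd
  rcases le_abs.1 hr with hr | hr <;> linarith

end Deterministic

/-! ### Concentration of block averages -/

section Probability

variable {ν : Fin 2 → Measure ℝ} {Ω : Type*} [MeasurableSpace Ω] {P : Measure Ω}
  {X : Fin 2 → ℕ → Ω → ℝ}

theorem measureReal_exists_mem_le {ι : Type*} (s : Finset ι) (p : ι → Ω → Prop) :
    P.real {ω | ∃ i ∈ s, p i ω} ≤ ∑ i ∈ s, P.real {ω | p i ω} := by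
  have : {ω | ∃ i ∈ s, p i ω} = ⋃ i ∈ s, {ω | p i ω} := by ext ω; simp
  rw [this]
  exact measureReal_biUnion_finset_le s _

theorem measureReal_exists_le {ι : Type*} [Fintype ι] (p : ι → Ω → Prop) :
    P.real {ω | ∃ i, p i ω} ≤ ∑ i, P.real {ω | p i ω} := by
  simpa using measureReal_exists_mem_le (P := P) Finset.univ p

theorem measureReal_or_le (p q : Ω → Prop) :
    P.real {ω | p ω ∨ q ω} ≤ P.real {ω | p ω} + P.real {ω | q ω} :=
  measureReal_union_le {ω | p ω} {ω | q ω}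

/-- Chernoff's bound for the average of a block of rewards of one arm. -/
theorem measureReal_deviation_le [IsProbabilityMeasure P] (hν : ∀ k, IsOneSubgaussian ν k)
    (hX : IsRewardTable P ν X) (k : Fin 2) (s m : ℕ) {c : ℝ} (hc : 0 ≤ c) :
    P.real {ω | c ≤ |blockAvg (fun k n => X k n ω) k s m - mean ν k|} ≤
      2 * Real.exp (-(m * c ^ 2 / 2)) := by
  rcases Nat.eq_zero_or_pos m with rfl | hm
  · have : P.real {ω | c ≤ |blockAvg (fun k n => X k n ω) k s 0 - mean ν k|} ≤ 1 :=
      measureReal_le_one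
    simp only [Nat.cast_zero, zero_mul, zero_div, neg_zero, Real.exp_zero]
    linarith
  have hm' : (0 : ℝ) < m := by exact_mod_cast hm
  have hind : iIndepFun (fun (i : ℕ) ω => X k (s + i) ω - mean ν k) P := by
    have h1 := hX.indep.precomp (g := fun i : ℕ => (k, s + i)) (fun i j h => by simpa using h)
    exact h1.comp (fun _ y => y - mean ν k) fun _ => measurable_id.sub_const _
  have hsub : ∀ i, HasSubgaussianMGF (fun ω => X k (s + i) ω - mean ν k) 1 P := by
    intro i
    have h := hν k
    rw [IsOneSubgaussian] at h
    nth_rw 1 [← hX.law k (s + i)] at h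
    exact HasSubgaussianMGF.of_map (hX.measurable k (s + i)).aemeasurable h
  have hind' : iIndepFun (fun (i : ℕ) ω => -(X k (s + i) ω - mean ν k)) P :=
    hind.comp (fun _ y => -y) fun _ => measurable_neg
  have hε : 0 ≤ m * c := by positivity
  have hup := HasSubgaussianMGF.measure_sum_ge_le_of_iIndepFun hind (s := Finset.range m)
    (c := fun _ => 1) (fun i _ => hsub i) hε
  have hlow := HasSubgaussianMGF.measure_sum_ge_le_of_iIndepFun hind' (s := Finset.range m)
    (c := fun _ => 1) (fun i _ => (hsub i).neg) hε
  have hexp : -(m * c) ^ 2 / (2 * ((∑ _i ∈ Finset.range m, (1 : NNReal) : NNReal) : ℝ)) =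
      -(m * c ^ 2 / 2) := by
    simp only [Finset.sum_const, Finset.card_range, nsmul_eq_mul, mul_one, NNReal.coe_natCast]
    field_simp
  rw [hexp] at hup hlow
  have havg : ∀ ω, (m : ℝ) * (blockAvg (fun k n => X k n ω) k s m - mean ν k) =
      ∑ i ∈ Finset.range m, (X k (s + i) ω - mean ν k) := by
    intro ω
    rw [blockAvg, Finset.sum_sub_distrib, mul_sub, mul_div_cancel₀ _ hm'.ne']
    simp
  refine (measureReal_mono (s₂ := {ω | m * c ≤ ∑ i ∈ Finset.range m, (X k (s + i) ω - mean ν k) ∨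
    m * c ≤ ∑ i ∈ Finset.range m, -(X k (s + i) ω - mean ν k)}) ?_).trans
    ((measureReal_or_le _ _).trans ((add_le_add hup hlow).trans_eq (two_mul _).symm))
  intro ω hω
  simp only [Set.mem_ofPred_eq, Finset.sum_neg_distrib, ← havg] at hω ⊢
  rcases le_abs.1 hω with h | h
  · exact Or.inl (mul_le_mul_of_nonneg_left h hm'.le)
  · right; rw [← mul_neg]; exact mul_le_mul_of_nonneg_left h hm'.le

end Probability

/-! ### The thresholds in Chernoff's bound -/

section Radii

/-- The value of the series `∑ mᵖ exp (-c m)`, which converges for `c > 0`. -/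
def expSeries (p : ℕ) (c : ℝ) : ℝ := ∑' m : ℕ, (m : ℝ) ^ p * Real.exp (-c * m)

theorem expSeries_nonneg (p : ℕ) (c : ℝ) : 0 ≤ expSeries p c :=
  tsum_nonneg fun _ => by positivity

theorem sum_le_expSeries (p : ℕ) {c : ℝ} (hc : 0 < c) (s : Finset ℕ) :
    ∑ m ∈ s, (m : ℝ) ^ p * Real.exp (-c * m) ≤ expSeries p c :=
  (Real.summable_pow_mul_exp_neg_nat_mul p hc).sum_le_tsum s fun _ _ => by positivity

theorem radiusI_sq (T₁ : ℝ) (s : ℕ) :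
    radiusI T₁ s ^ 2 = 16 / ((2 * s : ℕ) : ℝ) * logPlus (T₁ / ((2 * s : ℕ) : ℝ)) :=
  Real.sq_sqrt (mul_nonneg (by positivity) (le_max_left _ _))

theorem exp_neg_radiusI_le {T₁ : ℝ} (h₀ : 0 < T₁) {s : ℕ} (hs : 1 ≤ s) :
    Real.exp (-(s * radiusI T₁ s ^ 2 / 8)) ≤ 2 * s / T₁ := by
  have hs' : (0 : ℝ) < s := by exact_mod_cast hs
  have h1 : s * radiusI T₁ s ^ 2 / 8 = logPlus (T₁ / (2 * s)) := by
    rw [radiusI_sq]; push_cast; field_simp; ring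
  rw [h1, ← inv_div T₁, ← Real.exp_log (show 0 < T₁ / (2 * s) by positivity), ← Real.exp_neg,
    Real.exp_log (by positivity)]
  exact Real.exp_le_exp.2 (neg_le_neg (le_max_right _ _))

theorem one_le_logArg {T m : ℕ} (hm : 1 ≤ m) (hmT : m ≤ T) :
    1 ≤ (T : ℝ) / m * (Real.log (T / m) ^ 2 + 1) := by
  have hm' : (0 : ℝ) < m := by exact_mod_cast hm
  have h1 : 1 ≤ (T : ℝ) / m := (one_le_div hm').2 (by exact_mod_cast hmT)
  nlinarith [sq_nonneg (Real.log ((T : ℝ) / m))]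

theorem mul_radiusIII_sq {T m : ℕ} (hm : 1 ≤ m) (hmT : m ≤ T) :
    m * radiusIII T m ^ 2 = 2 * Real.log (T / m * (Real.log (T / m) ^ 2 + 1)) := by
  have hm' : (0 : ℝ) < m := by exact_mod_cast hm
  rw [radiusIII, Real.sq_sqrt (mul_nonneg (by positivity)
    (Real.log_nonneg (one_le_logArg hm hmT)))]
  field_simp

/-- For the threshold of Stage III, the factor in Chernoff's bound equals
`(m / T) / (log² (T / m) + 1)`; for small `m` this beats `1 / T` by a factor of order `log² T`. -/
theorem exp_neg_radiusIII_le {T m : ℕ} (hT : 2 ≤ T) (hm : 1 ≤ m) (hmT : m ≤ T) :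
    Real.exp (-(m * radiusIII T m ^ 2 / 2)) ≤ 4 * m ^ 3 / (T * Real.log T ^ 2) := by
  have hm' : (1 : ℝ) ≤ m := by exact_mod_cast hm
  have hm0 : (0 : ℝ) < m := by linarith
  have hT' : (2 : ℝ) ≤ T := by exact_mod_cast hT
  have hT0 : (0 : ℝ) < T := by linarith
  have hL : 0 < Real.log T := Real.log_pos (by linarith)
  have hlog : Real.log T = Real.log (T / m) + Real.log m := by
    rw [Real.log_div hT0.ne' hm0.ne']; ring
  rw [mul_radiusIII_sq hm hmT, mul_div_cancel_left₀ _ (two_ne_zero), Real.exp_neg,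
    Real.exp_log (by linarith [one_le_logArg hm hmT])]
  set a := Real.log ((T : ℝ) / m)
  have hlm : Real.log m ≤ m := (Real.log_le_sub_one_of_pos hm0).trans (by linarith)
  have hlm0 : 0 ≤ Real.log m := Real.log_nonneg hm'
  -- `log T = log (T / m) + log m`, so a small `log (T / m)` forces a large `m`
  have h1 : Real.log T ^ 2 ≤ 4 * m ^ 2 * (a ^ 2 + 1) := by
    have h2 : Real.log m ^ 2 ≤ m ^ 2 := by gcongr
    have h3 : Real.log T ^ 2 ≤ 2 * a ^ 2 + 2 * Real.log m ^ 2 := by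
      rw [hlog]; nlinarith [sq_nonneg (a - Real.log m)]
    nlinarith [mul_nonneg (sq_nonneg a) (show (0 : ℝ) ≤ m ^ 2 - 1 by nlinarith), sq_nonneg a,
      sq_nonneg (m : ℝ)]
  rw [inv_eq_one_div, div_le_div_iff₀ (by positivity) (by positivity)]
  calc 1 * (T * Real.log T ^ 2) ≤ T * (4 * m ^ 2 * (a ^ 2 + 1)) := by rw [one_mul]; gcongr
    _ = 4 * m ^ 3 * (T / m * (a ^ 2 + 1)) := by field_simp

theorem lt_commitCount (T₁ : ℝ) : T₁ < commitCount T₁ := by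
  rw [commitCount]; push_cast; exact Nat.lt_floor_add_one T₁

theorem commitCount_le {T₁ : ℝ} (h₀ : 0 ≤ T₁) : (commitCount T₁ : ℝ) ≤ T₁ + 1 := by
  rw [commitCount]; push_cast; linarith [Nat.floor_le h₀]

end Radii

/-! ### Probabilities of wrong decisions and of long tests -/

section Probability

variable {ν : Fin 2 → Measure ℝ} {Ω : Type*} [MeasurableSpace Ω] {P : Measure Ω}
  [IsProbabilityMeasure P] {X : Fin 2 → ℕ → Ω → ℝ}
  (hν : ∀ k, IsOneSubgaussian ν k) (hX : IsRewardTable P ν X)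
  {b : Fin 2} {Δ : ℝ} (hΔ : 0 < Δ) (hb : mean ν (1 - b) = mean ν b + Δ) (tie : Fin 2)
  {T : ℕ} {T₁ : ℝ}

include hν hX hΔ hb

theorem measureReal_leader_le (h₀ : 0 < T₁) :
    P.real {ω | leader tie T₁ (fun k n => X k n ω) = b} ≤
      8 * expSeries 1 (Δ ^ 2 / 8) / T₁ := by
  refine (measureReal_mono fun ω hω => exists_deviation_of_leader h₀.le hb hω).trans
    ((measureReal_exists_mem_le _ _).trans ?_)
  have hterm : ∀ s ∈ Finset.Icc 1 (commitCount T₁), P.real {ω | ∃ k : Fin 2,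
      (Δ + radiusI T₁ s) / 2 ≤ |blockAvg (fun k n => X k n ω) k 0 s - mean ν k|} ≤
      8 / T₁ * ((s : ℝ) ^ 1 * Real.exp (-(Δ ^ 2 / 8) * s)) := by
    intro s hs
    have hr : 0 ≤ radiusI T₁ s := Real.sqrt_nonneg _
    have hexp : Real.exp (-(s * ((Δ + radiusI T₁ s) / 2) ^ 2 / 2)) ≤
        2 * s / T₁ * Real.exp (-(Δ ^ 2 / 8) * s) := by
      refine le_trans ?_ (mul_le_mul_of_nonneg_right
        (exp_neg_radiusI_le h₀ (Finset.mem_Icc.1 hs).1) (Real.exp_pos _).le)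
      rw [← Real.exp_add]
      apply Real.exp_le_exp.2
      nlinarith [mul_nonneg (Nat.cast_nonneg (α := ℝ) s) (mul_nonneg hΔ.le hr)]
    refine (measureReal_exists_le _).trans ((Finset.sum_le_sum fun k _ =>
      measureReal_deviation_le hν hX k 0 s (by positivity)).trans ?_)
    rw [Fin.sum_univ_two]
    calc _ ≤ 2 * (2 * s / T₁ * Real.exp (-(Δ ^ 2 / 8) * s)) +
          2 * (2 * s / T₁ * Real.exp (-(Δ ^ 2 / 8) * s)) := by gcongr
      _ = _ := by ring
  refine (Finset.sum_le_sum hterm).trans ?_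
  rw [← Finset.mul_sum, mul_div_right_comm]
  exact mul_le_mul_of_nonneg_left (sum_le_expSeries 1 (by positivity) _) (by positivity)

theorem measureReal_lt_pairCount_le {s : ℕ} (hs : 1 ≤ s) (hr : radiusI T₁ s ≤ Δ / 2) :
    P.real {ω | s < pairCount T₁ (fun k n => X k n ω)} ≤ 4 * Real.exp (-(s * Δ ^ 2 / 32)) := by
  refine (measureReal_mono fun ω hω => exists_deviation_of_lt_pairCount hb hs hr hω).trans
    ((measureReal_exists_le _).trans ((Finset.sum_le_sum fun k _ =>
      measureReal_deviation_le hν hX k 0 s (by positivity)).trans_eq ?_))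
  rw [Fin.sum_univ_two, show s * (Δ / 4) ^ 2 / 2 = s * Δ ^ 2 / 32 by ring]
  ring

omit hΔ in
theorem measureReal_lt_testLength_le (h₀ : 0 ≤ T₁) {ε : ℝ} (hε : 0 ≤ ε) {m : ℕ} (hm : 1 ≤ m)
    (hr : radiusIII T m ≤ Δ - 2 * ε) :
    P.real {ω | leader tie T₁ (fun k n => X k n ω) = 1 - b ∧
      m < testLength tie T T₁ (fun k n => X k n ω)} ≤
      2 * Real.exp (-(commitCount T₁ * ε ^ 2 / 2)) +
        commitCount T₁ * (2 * Real.exp (-(m * ε ^ 2 / 2))) := by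
  refine (measureReal_mono fun ω hω =>
    exists_deviation_of_lt_testLength h₀ hb hω.1 hm hr hω.2).trans
    ((measureReal_or_le _ _).trans (add_le_add (measureReal_deviation_le hν hX _ _ _ hε)
      ((measureReal_exists_mem_le _ _).trans ((Finset.sum_le_sum fun s _ =>
        measureReal_deviation_le hν hX b s m hε).trans_eq ?_))))
  rw [Finset.sum_const, Nat.card_Icc, nsmul_eq_mul, Nat.add_sub_cancel]

/-- Stage III is rarely shorter than `M` if for all `m < M` the threshold is at least
`(Δ + 2ε) √(M / m)`: a stop at `m` then requires that the average of the leader deviates by `ε`, or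
that a block average of length `m` deviates by `ε √(M / m)`, and the latter has probability at most
`2 exp (-M ε² / 2)`. -/
theorem measureReal_testLength_lt_le (hT : 1 ≤ T) (h₀ : 0 ≤ T₁) {ε : ℝ} (hε : 0 ≤ ε) {M : ℕ}
    (hr : ∀ m : ℕ, 1 ≤ m → m < M → (Δ + 2 * ε) ^ 2 * M ≤ m * radiusIII T m ^ 2) :
    P.real {ω | leader tie T₁ (fun k n => X k n ω) = 1 - b ∧
      testLength tie T T₁ (fun k n => X k n ω) < M} ≤
      2 * Real.exp (-(commitCount T₁ * ε ^ 2 / 2)) +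
        M * (commitCount T₁ * (2 * Real.exp (-(M * ε ^ 2 / 2)))) := by
  have hsub : ∀ ω, (leader tie T₁ (fun k n => X k n ω) = 1 - b ∧
      testLength tie T T₁ (fun k n => X k n ω) < M) →
      ε ≤ |blockAvg (fun k n => X k n ω) (1 - b) 0 (commitCount T₁) - mean ν (1 - b)| ∨
      ∃ m ∈ Finset.Ico 1 M, ∃ s ∈ Finset.Icc 1 (commitCount T₁),
        radiusIII T m - Δ - ε ≤ |blockAvg (fun k n => X k n ω) b s m - mean ν b| := by
    rintro ω ⟨hl, hlt⟩
    refine (exists_deviation_of_testLength hT h₀ hb hΔ.le hl ε).imp_right fun h => ?_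
    exact ⟨_, Finset.mem_Ico.2 ⟨testLength_pos _ tie T₁, hlt⟩, h⟩
  refine (measureReal_mono hsub).trans ((measureReal_or_le _ _).trans (add_le_add
    (measureReal_deviation_le hν hX _ _ _ hε) ((measureReal_exists_mem_le _ _).trans ?_)))
  have hterm : ∀ m ∈ Finset.Ico 1 M, P.real {ω | ∃ s ∈ Finset.Icc 1 (commitCount T₁),
      radiusIII T m - Δ - ε ≤ |blockAvg (fun k n => X k n ω) b s m - mean ν b|} ≤
      commitCount T₁ * (2 * Real.exp (-(M * ε ^ 2 / 2))) := by
    intro m hm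
    obtain ⟨hm1, hmM⟩ := Finset.mem_Ico.1 hm
    have hr0 : 0 ≤ radiusIII T m := Real.sqrt_nonneg _
    have hu : 0 < √(m : ℝ) := Real.sqrt_pos.2 (by exact_mod_cast hm1)
    have huv : √(m : ℝ) ≤ √(M : ℝ) := Real.sqrt_le_sqrt (by exact_mod_cast hmM.le)
    have h1 : √(M : ℝ) * (Δ + 2 * ε) ≤ √(m : ℝ) * radiusIII T m := by
      refine abs_le_of_sq_le_sq' ?_ (by positivity) |>.2
      rw [mul_pow, mul_pow, Real.sq_sqrt (by positivity), Real.sq_sqrt (by positivity)]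
      linarith [hr m hm1 hmM]
    have h2 : √(M : ℝ) * ε ≤ √(m : ℝ) * (radiusIII T m - Δ - ε) := by
      nlinarith [mul_le_mul_of_nonneg_right huv (show 0 ≤ Δ + ε by positivity)]
    have h3 : 0 ≤ radiusIII T m - Δ - ε :=
      nonneg_of_mul_nonneg_right ((by positivity : 0 ≤ √(M : ℝ) * ε).trans h2) hu
    have h4 : M * ε ^ 2 ≤ m * (radiusIII T m - Δ - ε) ^ 2 := by
      have := pow_le_pow_left₀ (by positivity) h2 2
      rwa [mul_pow, mul_pow, Real.sq_sqrt (by positivity), Real.sq_sqrt (by positivity)] at this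
    refine (measureReal_exists_mem_le _ _).trans ((Finset.sum_le_sum fun s _ =>
        (measureReal_deviation_le hν hX b s m h3).trans (mul_le_mul_of_nonneg_left
          (Real.exp_le_exp.2 (show _ ≤ -(M * ε ^ 2 / 2) by linarith)) zero_le_two)).trans_eq ?_)
    rw [Finset.sum_const, Nat.card_Icc, nsmul_eq_mul, Nat.add_sub_cancel]
  refine (Finset.sum_le_sum hterm).trans ?_
  rw [Finset.sum_const, Nat.card_Ico, nsmul_eq_mul]
  have : ((M - 1 : ℕ) : ℝ) ≤ M := by exact_mod_cast Nat.sub_le _ _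
  gcongr

theorem measureReal_winner_le (hT : 2 ≤ T) (h₀ : 0 ≤ T₁) :
    P.real {ω | winner tie T T₁ (fun k n => X k n ω) = b} ≤
      4 * Real.exp (-(commitCount T₁ * Δ ^ 2 / 8)) +
        16 * commitCount T₁ * expSeries 3 (Δ ^ 2 / 8) / (T * Real.log T ^ 2) := by
  refine (measureReal_mono fun ω hω =>
    exists_deviation_of_winner (by omega) h₀ hb hω).trans
    ((measureReal_or_le _ _).trans (add_le_add ?_ ?_))
  · refine (measureReal_exists_le _).trans ((Finset.sum_le_sum fun k _ =>
      measureReal_deviation_le hν hX k 0 (commitCount T₁) (by positivity)).trans_eq ?_)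
    rw [Fin.sum_univ_two,
      show commitCount T₁ * (Δ / 2) ^ 2 / 2 = commitCount T₁ * Δ ^ 2 / 8 by ring]
    ring
  have hterm : ∀ k s, ∀ m ∈ Finset.Icc 1 T, P.real {ω | radiusIII T m + Δ / 2 ≤
      |blockAvg (fun k n => X k n ω) k s m - mean ν k|} ≤
      8 / (T * Real.log T ^ 2) * ((m : ℝ) ^ 3 * Real.exp (-(Δ ^ 2 / 8) * m)) := by
    intro k s m hm
    obtain ⟨hm1, hmT⟩ := Finset.mem_Icc.1 hm
    have hr0 : 0 ≤ radiusIII T m := Real.sqrt_nonneg _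
    have hexp : Real.exp (-(m * (radiusIII T m + Δ / 2) ^ 2 / 2)) ≤
        4 * m ^ 3 / (T * Real.log T ^ 2) * Real.exp (-(Δ ^ 2 / 8) * m) := by
      refine le_trans ?_ (mul_le_mul_of_nonneg_right
        (exp_neg_radiusIII_le hT hm1 hmT) (Real.exp_pos _).le)
      rw [← Real.exp_add]
      apply Real.exp_le_exp.2
      nlinarith [mul_nonneg (Nat.cast_nonneg (α := ℝ) m) (mul_nonneg hΔ.le hr0)]
    refine (measureReal_deviation_le hν hX k s m (by positivity)).trans
      ((mul_le_mul_of_nonneg_left hexp zero_le_two).trans_eq (by ring))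
  have hsum : ∀ k s, P.real {ω | ∃ m ∈ Finset.Icc 1 T, radiusIII T m + Δ / 2 ≤
      |blockAvg (fun k n => X k n ω) k s m - mean ν k|} ≤
      8 / (T * Real.log T ^ 2) * expSeries 3 (Δ ^ 2 / 8) := by
    intro k s
    refine (measureReal_exists_mem_le _ _).trans ((Finset.sum_le_sum (hterm k s)).trans ?_)
    rw [← Finset.mul_sum]
    exact mul_le_mul_of_nonneg_left (sum_le_expSeries 3 (by positivity) _) (by positivity)
  refine (measureReal_exists_le _).trans ((Finset.sum_le_sum fun k _ =>
    (measureReal_exists_mem_le _ _).trans (Finset.sum_le_sum fun s _ => hsum k s)).trans_eq ?_)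
  rw [Fin.sum_univ_two, Finset.sum_const, Nat.card_Icc, nsmul_eq_mul, Nat.add_sub_cancel]
  ring

end Probability

/-! ### Bounds on the expected number of pulls of the worse arm -/

section Expectation

variable {ν : Fin 2 → Measure ℝ} {Ω : Type*} [MeasurableSpace Ω] {P : Measure Ω}
  [IsProbabilityMeasure P] {X : Fin 2 → ℕ → Ω → ℝ}
  (hν : ∀ k, IsOneSubgaussian ν k) (hX : IsRewardTable P ν X)
  {b : Fin 2} {Δ : ℝ} (hΔ : 0 < Δ) (hb : mean ν (1 - b) = mean ν b + Δ) (tie : Fin 2)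
  {T : ℕ} {T₁ : ℝ}

include hX in
/-- The four stages contribute separately to the number of pulls of arm `b`: Stage I at most `s₀`
pulls unless it is long, Stage II only if `b` is the leader, Stage III only if `b` is not, and Stage
IV only if `b` is the winner. -/
theorem integral_armCount_le_sum (hT : 1 ≤ T) (h₀ : 0 ≤ T₁) (b : Fin 2) (s₀ m₀ : ℕ) :
    ∫ ω, (armCount tie T T₁ b fun k n => X k n ω : ℝ) ∂P ≤ s₀ + m₀ +
      commitCount T₁ * P.real {ω | s₀ < pairCount T₁ (fun k n => X k n ω)} +
      commitCount T₁ * P.real {ω | leader tie T₁ (fun k n => X k n ω) = b} +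
      ∑ m ∈ Finset.Ico m₀ T, P.real {ω | leader tie T₁ (fun k n => X k n ω) = 1 - b ∧
        m < testLength tie T T₁ (fun k n => X k n ω)} +
      T * P.real {ω | winner tie T T₁ (fun k n => X k n ω) = b} := by
  have hXm := hX.measurable_table
  set A := {ω | s₀ < pairCount T₁ (fun k n => X k n ω)} with hA
  set B := {ω | leader tie T₁ (fun k n => X k n ω) = b} with hB
  set C : ℕ → Set Ω := fun m => {ω | leader tie T₁ (fun k n => X k n ω) = 1 - b ∧
        m < testLength tie T T₁ (fun k n => X k n ω)} with hC
  set D := {ω | winner tie T T₁ (fun k n => X k n ω) = b} with hD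
  have mA : MeasurableSet A :=
    measurableSet_lt measurable_const ((measurable_pairCount h₀).comp hXm)
  have mB : MeasurableSet B := (measurable_leader tie h₀).comp hXm (measurableSet_singleton b)
  have mC : ∀ m, MeasurableSet (C m) := fun m =>
    ((measurable_leader tie h₀).comp hXm (measurableSet_singleton (1 - b))).inter
      (measurableSet_lt measurable_const ((measurable_testLength tie hT h₀).comp hXm))
  have mD : MeasurableSet D := (measurable_winner tie hT h₀).comp hXm (measurableSet_singleton b)
  have hI : ∀ {S : Set Ω}, MeasurableSet S → Integrable (S.indicator (1 : Ω → ℝ)) P :=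
    fun hS => (integrable_const (1 : ℝ)).indicator hS
  have hpt : ∀ ω, (armCount tie T T₁ b (fun k n => X k n ω) : ℝ) ≤ s₀ + m₀ +
      commitCount T₁ * A.indicator 1 ω + commitCount T₁ * B.indicator 1 ω +
      ∑ m ∈ Finset.Ico m₀ T, (C m).indicator 1 ω + T * D.indicator 1 ω := by
    intro ω
    set x : Fin 2 → ℕ → ℝ := fun k n => X k n ω with hx
    have h1 : (armCount tie T T₁ b x : ℝ) ≤ pairCount T₁ x +
        (if leader tie T₁ x = b then (commitCount T₁ : ℝ) else 0) +
        (if leader tie T₁ x = 1 - b then (testLength tie T T₁ x : ℝ) else 0) +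
        (if winner tie T T₁ x = b then (T : ℝ) else 0) := by
      have hiff : 1 - leader tie T₁ x = b ↔ leader tie T₁ x = 1 - b := by omega
      have := armCount_le x tie hT h₀ b
      simp only [hiff] at this
      exact_mod_cast this
    have hAω : (pairCount T₁ x : ℝ) ≤ s₀ + commitCount T₁ * A.indicator 1 ω := by
      by_cases h : ω ∈ A
      · have : (pairCount T₁ x : ℝ) ≤ commitCount T₁ := by exact_mod_cast pairCount_le x h₀
        simp only [Set.indicator_of_mem h, Pi.one_apply]
        linarith [Nat.cast_nonneg (α := ℝ) s₀]
      · have : (pairCount T₁ x : ℝ) ≤ s₀ := by exact_mod_cast not_lt.1 h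
        simpa only [Set.indicator_of_notMem h, mul_zero, add_zero]
    have hBω : (if leader tie T₁ x = b then (commitCount T₁ : ℝ) else 0) =
        commitCount T₁ * B.indicator 1 ω := by
      by_cases h : ω ∈ B
      · have h' : leader tie T₁ x = b := h
        simp [h, h']
      · have h' : ¬ leader tie T₁ x = b := h
        simp [h, h']
    have hDω : (if winner tie T T₁ x = b then (T : ℝ) else 0) = T * D.indicator 1 ω := by
      by_cases h : ω ∈ D
      · have h' : winner tie T T₁ x = b := h
        simp [h, h']
      · have h' : ¬ winner tie T T₁ x = b := h
        simp [h, h']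
    have hCω : (if leader tie T₁ x = 1 - b then (testLength tie T T₁ x : ℝ) else 0) ≤
        m₀ + ∑ m ∈ Finset.Ico m₀ T, (C m).indicator 1 ω := by
      have h0 : 0 ≤ ∑ m ∈ Finset.Ico m₀ T, (C m).indicator (1 : Ω → ℝ) ω :=
        Finset.sum_nonneg fun m _ => Set.indicator_nonneg (fun _ _ => zero_le_one) ω
      split_ifs with hl
      · have hle : ∑ m ∈ Finset.Ico m₀ (testLength tie T T₁ x), (1 : ℝ) ≤
            ∑ m ∈ Finset.Ico m₀ T, (C m).indicator 1 ω := by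
          refine (Finset.sum_le_sum_of_subset_of_nonneg (f := fun m => (C m).indicator 1 ω)
            (Finset.Ico_subset_Ico_right (testLength_le x tie T₁ hT))
            fun m _ _ => Set.indicator_nonneg (fun _ _ => zero_le_one) ω).trans' ?_
          refine Finset.sum_le_sum fun m hm => ?_
          have : ω ∈ C m := ⟨hl, (Finset.mem_Ico.1 hm).2⟩
          rw [Set.indicator_of_mem this]; rfl
        rw [Finset.sum_const, Nat.card_Ico, nsmul_eq_mul, mul_one] at hle
        have : (testLength tie T T₁ x : ℝ) ≤ m₀ + (testLength tie T T₁ x - m₀ : ℕ) := by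
          exact_mod_cast (by omega)
        linarith
      · positivity
    rw [hBω, hDω] at h1
    linarith
  have iA : Integrable (fun ω => (commitCount T₁ : ℝ) * A.indicator 1 ω) P := (hI mA).const_mul _
  have iB : Integrable (fun ω => (commitCount T₁ : ℝ) * B.indicator 1 ω) P := (hI mB).const_mul _
  have iC : Integrable (fun ω => ∑ m ∈ Finset.Ico m₀ T, (C m).indicator (1 : Ω → ℝ) ω) P :=
    integrable_finsetSum _ fun m _ => hI (mC m)
  have iD : Integrable (fun ω => (T : ℝ) * D.indicator 1 ω) P := (hI mD).const_mul _
  have ic : Integrable (fun _ : Ω => (s₀ : ℝ) + m₀) P := integrable_const _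
  refine (integral_mono (integrable_armCount hX tie hT h₀ b)
    ((((ic.add iA).add iB).add iC).add iD) hpt).trans_eq ?_
  rw [integral_add' (((ic.add iA).add iB).add iC) iD, integral_add' ((ic.add iA).add iB) iC,
    integral_add' (ic.add iA) iB, integral_add' ic iA, integral_const_mul, integral_const_mul,
    integral_const_mul, integral_finsetSum _ fun m _ => hI (mC m), integral_indicator_one mA,
    integral_indicator_one mB, integral_indicator_one mD]
  simp only [integral_indicator_one (mC _)]
  simp [C]

include hν hX hΔ hb

theorem integral_armCount_le (hT : 2 ≤ T) (h₀ : 0 < T₁) {ε : ℝ} (hε : 0 < ε) {s₀ m₀ : ℕ}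
    (hs₀ : 1 ≤ s₀) (hm₀ : 1 ≤ m₀) (hrI : radiusI T₁ s₀ ≤ Δ / 2)
    (hrIII : ∀ m, m₀ ≤ m → m < T → radiusIII T m ≤ Δ - 2 * ε) :
    ∫ ω, (armCount tie T T₁ b fun k n => X k n ω : ℝ) ∂P ≤ s₀ + m₀ +
      commitCount T₁ * (4 * Real.exp (-(s₀ * Δ ^ 2 / 32))) +
      commitCount T₁ * (8 * expSeries 1 (Δ ^ 2 / 8) / T₁) +
      (T * (2 * Real.exp (-(commitCount T₁ * ε ^ 2 / 2))) +
        commitCount T₁ * (2 * (Real.exp (-(m₀ * ε ^ 2 / 4)) * expSeries 0 (ε ^ 2 / 4)))) +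
      (T * (4 * Real.exp (-(commitCount T₁ * Δ ^ 2 / 8))) +
        16 * commitCount T₁ * expSeries 3 (Δ ^ 2 / 8) / Real.log T ^ 2) := by
  have hT0 : (0 : ℝ) < T := by exact_mod_cast (by omega : 0 < T)
  refine (integral_armCount_le_sum hX tie (by omega) h₀.le b s₀ m₀).trans ?_
  gcongr
  · exact measureReal_lt_pairCount_le hν hX hΔ hb hs₀ hrI
  · exact measureReal_leader_le hν hX hΔ hb tie h₀
  · have hterm : ∀ m ∈ Finset.Ico m₀ T, P.real {ω | leader tie T₁ (fun k n => X k n ω) = 1 - b ∧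
        m < testLength tie T T₁ (fun k n => X k n ω)} ≤
        2 * Real.exp (-(commitCount T₁ * ε ^ 2 / 2)) + commitCount T₁ * (2 * Real.exp
          (-(m₀ * ε ^ 2 / 4))) * ((m : ℝ) ^ 0 * Real.exp (-(ε ^ 2 / 4) * m)) := by
      intro m hm
      obtain ⟨hm1, hmT⟩ := Finset.mem_Ico.1 hm
      refine (measureReal_lt_testLength_le hν hX hb tie h₀.le hε.le (hm₀.trans hm1)
        (hrIII m hm1 hmT)).trans ?_
      rw [pow_zero, one_mul, mul_assoc, mul_assoc, ← Real.exp_add]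
      gcongr
      have : (m₀ : ℝ) ≤ m := by exact_mod_cast hm1
      nlinarith [mul_le_mul_of_nonneg_right this (sq_nonneg ε)]
    refine (Finset.sum_le_sum hterm).trans ?_
    rw [Finset.sum_add_distrib, Finset.sum_const, nsmul_eq_mul, ← Finset.mul_sum, Nat.card_Ico]
    have h1 : ((T - m₀ : ℕ) : ℝ) ≤ T := by exact_mod_cast Nat.sub_le _ _
    have h2 := sum_le_expSeries 0 (show 0 < ε ^ 2 / 4 by positivity) (Finset.Ico m₀ T)
    refine add_le_add (by gcongr) ?_
    rw [mul_assoc, mul_assoc]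
    gcongr
  · refine (mul_le_mul_of_nonneg_left (measureReal_winner_le hν hX hΔ hb tie hT h₀.le)
      hT0.le).trans_eq ?_
    field_simp

theorem le_integral_armCount (hT : 1 ≤ T) (h₀ : 0 < T₁) {ε : ℝ} (hε : 0 ≤ ε) {M : ℕ}
    (hMT : 2 * commitCount T₁ + M ≤ T)
    (hr : ∀ m : ℕ, 1 ≤ m → m < M → (Δ + 2 * ε) ^ 2 * M ≤ m * radiusIII T m ^ 2) :
    M * (1 - (8 * expSeries 1 (Δ ^ 2 / 8) / T₁ +
      (2 * Real.exp (-(commitCount T₁ * ε ^ 2 / 2)) +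
        M * (commitCount T₁ * (2 * Real.exp (-(M * ε ^ 2 / 2))))))) ≤
      ∫ ω, (armCount tie T T₁ b fun k n => X k n ω : ℝ) ∂P := by
  have hXm := hX.measurable_table
  set A := {ω | leader tie T₁ (fun k n => X k n ω) = b} with hA
  set B := {ω | leader tie T₁ (fun k n => X k n ω) = 1 - b ∧
      testLength tie T T₁ (fun k n => X k n ω) < M} with hB
  have mA : MeasurableSet A := (measurable_leader tie h₀.le).comp hXm (measurableSet_singleton b)
  have mB : MeasurableSet B :=
    ((measurable_leader tie h₀.le).comp hXm (measurableSet_singleton (1 - b))).inter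
      (measurableSet_lt ((measurable_testLength tie hT h₀.le).comp hXm) measurable_const)
  have hprob : P.real (A ∪ B) ≤ 8 * expSeries 1 (Δ ^ 2 / 8) / T₁ +
      (2 * Real.exp (-(commitCount T₁ * ε ^ 2 / 2)) +
        M * (commitCount T₁ * (2 * Real.exp (-(M * ε ^ 2 / 2))))) :=
    (measureReal_union_le A B).trans (add_le_add (measureReal_leader_le hν hX hΔ hb tie h₀)
      (measureReal_testLength_lt_le hν hX hΔ hb tie hT h₀.le hε hr))
  have hpt : ∀ ω, (A ∪ B)ᶜ.indicator (fun _ => (M : ℝ)) ω ≤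
      (armCount tie T T₁ b (fun k n => X k n ω) : ℝ) := by
    intro ω
    by_cases hω : ω ∈ A ∪ B
    · rw [Set.indicator_of_notMem (Set.notMem_compl_iff.2 hω)]; exact Nat.cast_nonneg _
    rw [Set.indicator_of_mem (Set.mem_compl hω)]
    have hl : leader tie T₁ (fun k n => X k n ω) = 1 - b := by
      have : ¬ leader tie T₁ (fun k n => X k n ω) = b := fun h => hω (Or.inl h)
      omega
    have hM : M ≤ testLength tie T T₁ (fun k n => X k n ω) :=
      not_lt.1 fun h => hω (Or.inr ⟨hl, h⟩)
    have := le_armCount _ tie hT h₀.le hM hMT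
    rw [hl, sub_sub_cancel] at this
    exact_mod_cast this
  calc _ ≤ (M : ℝ) * (1 - P.real (A ∪ B)) := by gcongr
    _ = ∫ ω, (A ∪ B)ᶜ.indicator (fun _ => (M : ℝ)) ω ∂P := by
      rw [integral_indicator_const _ (mA.union mB).compl, probReal_compl_eq_one_sub (mA.union mB),
        smul_eq_mul, mul_comm]
    _ ≤ _ := integral_mono ((integrable_const _).indicator (mA.union mB).compl)
      (integrable_armCount hX tie hT h₀.le b) hpt

end Expectation

/-! ### Asymptotics -/

section Growth

theorem eventually_log_le {c : ℝ} (hc : 0 < c) : ∀ᶠ L : ℝ in atTop, Real.log L ≤ c * L := by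
  filter_upwards [Real.isLittleO_log_id_atTop.bound hc, eventually_ge_atTop 0] with L h h0
  rw [id, Real.norm_of_nonneg h0] at h
  exact (le_abs_self _).trans h

theorem eventually_log_sq_add_one_le {c : ℝ} (hc : 0 < c) :
    ∀ᶠ L : ℝ in atTop, Real.log (L ^ 2 + 1) ≤ c * L := by
  filter_upwards [eventually_log_le (show 0 < c / 3 by positivity), eventually_ge_atTop 2]
    with L h h2
  have h1 : Real.log (L ^ 2 + 1) ≤ Real.log (L ^ 3) := by
    apply Real.log_le_log (by positivity)
    nlinarith [mul_nonneg (show 0 ≤ L - 2 by linarith) (sq_nonneg L)]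
  rw [Real.log_pow] at h1
  push_cast at h1
  linarith

theorem eventually_exp_sub_sq_le {c ρ : ℝ} (hc : 0 < c) (hρ : 0 < ρ) :
    ∀ᶠ L : ℝ in atTop, Real.exp (L - c * L ^ 2) ≤ ρ := by
  filter_upwards [eventually_ge_atTop ((1 + |Real.log ρ|) / c), eventually_ge_atTop 1] with L h h1
  rw [div_le_iff₀ hc] at h
  rw [← Real.le_log_iff_exp_le hρ]
  have : L * (1 + |Real.log ρ|) ≤ L * (L * c) := by gcongr
  nlinarith [neg_abs_le (Real.log ρ), abs_nonneg (Real.log ρ)]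

theorem eventually_pow_mul_exp_le (p : ℕ) {c ρ : ℝ} (hc : 0 < c) (hρ : 0 < ρ) :
    ∀ᶠ L : ℝ in atTop, L ^ p * Real.exp (-(c * L)) ≤ ρ := by
  have h := tendsto_rpow_mul_exp_neg_mul_atTop_nhds_zero p c hc
  filter_upwards [h.eventually_le_const hρ] with L hL
  rwa [Real.rpow_natCast, neg_mul] at hL

end Growth

section Radii

theorem mul_radiusI_sq_le {L : ℝ} (hL : 1 ≤ L) {s : ℕ} (hs : 1 ≤ s) :
    s * radiusI (L ^ 2) s ^ 2 ≤ 16 * Real.log L := by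
  have hs' : (1 : ℝ) ≤ s := by exact_mod_cast hs
  have h1 : s * radiusI (L ^ 2) s ^ 2 = 8 * logPlus (L ^ 2 / (2 * s)) := by
    rw [radiusI_sq]; push_cast; field_simp; ring
  have h2 : logPlus (L ^ 2 / (2 * s)) ≤ Real.log (L ^ 2) := by
    refine max_le (Real.log_nonneg (one_le_pow₀ hL)) (Real.log_le_log (by positivity) ?_)
    exact div_le_self (by positivity) (by linarith)
  rw [Real.log_pow] at h2
  push_cast at h2
  linarith

theorem mul_radiusIII_sq_le {T m : ℕ} (hm : 1 ≤ m) (hmT : m ≤ T) :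
    m * radiusIII T m ^ 2 ≤ 2 * (Real.log T + Real.log (Real.log T ^ 2 + 1)) := by
  have hm' : (1 : ℝ) ≤ m := by exact_mod_cast hm
  have hT' : (m : ℝ) ≤ T := by exact_mod_cast hmT
  have h1 : 1 ≤ (T : ℝ) / m := (one_le_div (by linarith)).2 hT'
  have h2 : (T : ℝ) / m ≤ T := div_le_self (by linarith) hm'
  have h3 : 0 ≤ Real.log ((T : ℝ) / m) := Real.log_nonneg h1
  have h4 : Real.log ((T : ℝ) / m) ≤ Real.log T := Real.log_le_log (by linarith) h2
  rw [mul_radiusIII_sq hm hmT, ← Real.log_mul (by linarith) (by positivity)]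
  refine mul_le_mul_of_nonneg_left (Real.log_le_log (by linarith [one_le_logArg hm hmT]) ?_)
    zero_le_two
  gcongr

theorem le_mul_radiusIII_sq {T m : ℕ} (hm : 1 ≤ m) (hmT : m ≤ T) :
    2 * (Real.log T - Real.log m) ≤ m * radiusIII T m ^ 2 := by
  have hm' : (1 : ℝ) ≤ m := by exact_mod_cast hm
  have hT' : (m : ℝ) ≤ T := by exact_mod_cast hmT
  rw [mul_radiusIII_sq hm hmT, ← Real.log_div (by linarith) (by linarith)]
  have h1 : 0 < (T : ℝ) / m := div_pos (by linarith) (by linarith)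
  refine mul_le_mul_of_nonneg_left (Real.log_le_log h1 ?_) zero_le_two
  exact le_mul_of_one_le_right h1.le (by linarith [sq_nonneg (Real.log ((T : ℝ) / m))])

theorem radiusI_le {L η c : ℝ} (hL : 1 ≤ L) {s : ℕ} (hs : 1 ≤ s) (hηs : η * L ≤ s) (hc : 0 ≤ c)
    (hlog : 16 * Real.log L ≤ η * L * c ^ 2) : radiusI (L ^ 2) s ≤ c := by
  have h1 : η * L * c ^ 2 ≤ s * c ^ 2 := by gcongr
  have h2 : s * radiusI (L ^ 2) s ^ 2 ≤ s * c ^ 2 := by linarith [mul_radiusI_sq_le hL hs]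
  exact (abs_le_of_sq_le_sq' (le_of_mul_le_mul_left h2 (by exact_mod_cast hs)) hc).2

theorem radiusIII_le {T m : ℕ} {κ c : ℝ} (hm : 1 ≤ m) (hmT : m ≤ T) (hκm : κ * Real.log T ≤ m)
    (hc : 0 ≤ c) (hlog : 2 * (Real.log T + Real.log (Real.log T ^ 2 + 1)) ≤
      κ * Real.log T * c ^ 2) : radiusIII T m ≤ c := by
  have h1 : κ * Real.log T * c ^ 2 ≤ m * c ^ 2 := by gcongr
  have h2 : m * radiusIII T m ^ 2 ≤ m * c ^ 2 := by linarith [mul_radiusIII_sq_le hm hmT]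
  exact (abs_le_of_sq_le_sq' (le_of_mul_le_mul_left h2 (by exact_mod_cast hm)) hc).2

end Radii

section Limits

variable {ν : Fin 2 → Measure ℝ} {Ω : Type*} [MeasurableSpace Ω] {P : Measure Ω}
  [IsProbabilityMeasure P] {X : Fin 2 → ℕ → Ω → ℝ}
  (hν : ∀ k, IsOneSubgaussian ν k) (hX : IsRewardTable P ν X)
  {b : Fin 2} {Δ : ℝ} (hΔ : 0 < Δ) (hb : mean ν (1 - b) = mean ν b + Δ) (tie : Fin 2)

theorem tendsto_log_natCast : Tendsto (fun T : ℕ => Real.log T) atTop atTop :=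
  Real.tendsto_log_atTop.comp tendsto_natCast_atTop_atTop

include hν hX hΔ hb

theorem eventually_integral_armCount_le {κ : ℝ} (hκ : 2 / Δ ^ 2 < κ) :
    ∀ᶠ T : ℕ in atTop, ∫ ω, (armCount tie T (Real.log T ^ 2) b fun k n => X k n ω : ℝ) ∂P ≤
      κ * Real.log T := by
  obtain ⟨κ₁, hκ₁, hκ₁κ⟩ := exists_between hκ
  have hκ₁0 : 0 < κ₁ := lt_trans (by positivity) hκ₁
  set η := (κ - κ₁) / 2 with hη
  have hη0 : 0 < η := by linarith
  -- `ε` is so small that `κ₁ log T` pulls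
  -- with averages at distance `Δ - 2ε` suffice to end Stage III
  obtain ⟨ε, ⟨hε1, hε2⟩, hε0⟩ : ∃ ε : ℝ, (2 < κ₁ * (Δ - 2 * ε) ^ 2 ∧ 2 * ε < Δ) ∧ 0 < ε := by
    have h1 : ∀ᶠ ε : ℝ in 𝓝 0, 2 < κ₁ * (Δ - 2 * ε) ^ 2 := by
      have hc : Continuous fun ε : ℝ => κ₁ * (Δ - 2 * ε) ^ 2 := by fun_prop
      refine hc.continuousAt.eventually_const_lt ?_
      rw [div_lt_iff₀ (by positivity)] at hκ₁
      simpa using hκ₁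
    have h2 : ∀ᶠ ε : ℝ in 𝓝 0, 2 * ε < Δ := by
      have hc : Continuous fun ε : ℝ => 2 * ε := by fun_prop
      exact hc.continuousAt.eventually_lt_const (by simpa using hΔ)
    exact (((h1.and h2).filter_mono nhdsWithin_le_nhds).and
      (self_mem_nhdsWithin (s := Set.Ioi (0 : ℝ)))).exists
  set S₀ := expSeries 0 (ε ^ 2 / 4)
  set S₁ := expSeries 1 (Δ ^ 2 / 8)
  set S₃ := expSeries 3 (Δ ^ 2 / 8)
  have hS₀ : 0 ≤ S₀ := expSeries_nonneg _ _
  have hS₁ : 0 ≤ S₁ := expSeries_nonneg _ _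
  have hS₃ : 0 ≤ S₃ := expSeries_nonneg _ _
  set K := 2 + 2 * 4 + 16 * S₁ + (2 + 4 * S₀) + (4 + 32 * S₃) with hK
  set c := (κ₁ * (Δ - 2 * ε) ^ 2 - 2) / 2 with hc
  have hreal : ∀ᶠ L : ℝ in atTop, 1 ≤ L ∧ Real.log L ≤ η * Δ ^ 2 / 64 * L ∧
      Real.log (L ^ 2 + 1) ≤ c * L ∧ L ^ 2 * Real.exp (-(η * Δ ^ 2 / 32 * L)) ≤ 1 ∧
      L ^ 2 * Real.exp (-(κ₁ * ε ^ 2 / 4 * L)) ≤ 1 ∧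
      Real.exp (L - ε ^ 2 / 2 * L ^ 2) ≤ 1 ∧ Real.exp (L - Δ ^ 2 / 8 * L ^ 2) ≤ 1 ∧
      K ≤ η * L := by
    filter_upwards [eventually_ge_atTop 1, eventually_log_le (c := η * Δ ^ 2 / 64) (by positivity),
      eventually_log_sq_add_one_le (c := c) (by linarith),
      eventually_pow_mul_exp_le 2 (c := η * Δ ^ 2 / 32) (by positivity) one_pos,
      eventually_pow_mul_exp_le 2 (c := κ₁ * ε ^ 2 / 4) (by positivity) one_pos,
      eventually_exp_sub_sq_le (c := ε ^ 2 / 2) (by positivity) one_pos,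
      eventually_exp_sub_sq_le (c := Δ ^ 2 / 8) (by positivity) one_pos,
      eventually_ge_atTop (K / η)] with L h1 h2 h3 h4 h5 h6 h7 h8
    exact ⟨h1, h2, h3, h4, h5, h6, h7, by rwa [div_le_iff₀' hη0] at h8⟩
  filter_upwards [tendsto_log_natCast.eventually hreal, eventually_ge_atTop 2] with T hT hT2
  have hT0 : (0 : ℝ) < T := by exact_mod_cast (by omega : 0 < T)
  have hexpT : (T : ℝ) = Real.exp (Real.log T) := (Real.exp_log hT0).symm
  set L := Real.log T with hL
  obtain ⟨h1, h2, h3, h4, h5, h6, h7, h8⟩ := hT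
  set s₀ := ⌈η * L⌉₊ with hs₀
  set m₀ := ⌈κ₁ * L⌉₊ with hm₀
  have hL0 : 0 < L := by linarith
  have hs₀1 : 1 ≤ s₀ := Nat.ceil_pos.2 (by positivity)
  have hm₀1 : 1 ≤ m₀ := Nat.ceil_pos.2 (by positivity)
  have hs₀l : η * L ≤ s₀ := Nat.le_ceil _
  have hm₀l : κ₁ * L ≤ m₀ := Nat.le_ceil _
  have hs₀u : (s₀ : ℝ) ≤ η * L + 1 := (Nat.ceil_lt_add_one (by positivity)).le
  have hm₀u : (m₀ : ℝ) ≤ κ₁ * L + 1 := (Nat.ceil_lt_add_one (by positivity)).le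
  have hrI : radiusI (L ^ 2) s₀ ≤ Δ / 2 :=
    radiusI_le h1 hs₀1 hs₀l (by positivity) (by linear_combination 16 * h2)
  have hrIII : ∀ m, m₀ ≤ m → m < T → radiusIII T m ≤ Δ - 2 * ε := fun m hm hmT =>
    radiusIII_le (hm₀1.trans hm) hmT.le (hm₀l.trans (by exact_mod_cast hm)) (by linarith)
      (by rw [hc] at h3; linear_combination 2 * h3)
  have hmain := integral_armCount_le hν hX hΔ hb tie hT2 (T₁ := L ^ 2) (by positivity) hε0 hs₀1
    hm₀1 hrI hrIII
  have hN1 : L ^ 2 ≤ commitCount (L ^ 2) := (lt_commitCount _).le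
  have hN2 : (commitCount (L ^ 2) : ℝ) ≤ 2 * L ^ 2 :=
    (commitCount_le (by positivity)).trans (by nlinarith)
  have e1 : commitCount (L ^ 2) * (4 * Real.exp (-(s₀ * Δ ^ 2 / 32))) ≤ 2 * 4 := by
    have : Real.exp (-(s₀ * Δ ^ 2 / 32)) ≤ Real.exp (-(η * Δ ^ 2 / 32 * L)) := by
      refine Real.exp_le_exp.2 (neg_le_neg ?_)
      calc η * Δ ^ 2 / 32 * L = η * L * Δ ^ 2 / 32 := by ring
        _ ≤ s₀ * Δ ^ 2 / 32 := by gcongr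
    calc _ ≤ 2 * L ^ 2 * (4 * Real.exp (-(η * Δ ^ 2 / 32 * L))) := by gcongr
      _ = 2 * 4 * (L ^ 2 * Real.exp (-(η * Δ ^ 2 / 32 * L))) := by ring
      _ ≤ 2 * 4 := by linarith
  have e2 : commitCount (L ^ 2) * (8 * S₁ / L ^ 2) ≤ 16 * S₁ := by
    calc _ ≤ 2 * L ^ 2 * (8 * S₁ / L ^ 2) := by gcongr
      _ = 16 * S₁ := by field_simp; ring
  have e3 : T * (2 * Real.exp (-(commitCount (L ^ 2) * ε ^ 2 / 2))) ≤ 2 := by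
    have : Real.exp (-(commitCount (L ^ 2) * ε ^ 2 / 2)) ≤ Real.exp (-(ε ^ 2 / 2 * L ^ 2)) := by
      refine Real.exp_le_exp.2 (neg_le_neg ?_)
      calc ε ^ 2 / 2 * L ^ 2 = L ^ 2 * ε ^ 2 / 2 := by ring
        _ ≤ commitCount (L ^ 2) * ε ^ 2 / 2 := by gcongr
    calc _ ≤ T * (2 * Real.exp (-(ε ^ 2 / 2 * L ^ 2))) := by gcongr
      _ = 2 * Real.exp (L - ε ^ 2 / 2 * L ^ 2) := by
        rw [sub_eq_add_neg, Real.exp_add, ← hexpT]; ring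
      _ ≤ 2 := by linarith
  have e4 : commitCount (L ^ 2) * (2 * (Real.exp (-(m₀ * ε ^ 2 / 4)) * S₀)) ≤ 4 * S₀ := by
    have : Real.exp (-(m₀ * ε ^ 2 / 4)) ≤ Real.exp (-(κ₁ * ε ^ 2 / 4 * L)) := by
      refine Real.exp_le_exp.2 (neg_le_neg ?_)
      calc κ₁ * ε ^ 2 / 4 * L = κ₁ * L * ε ^ 2 / 4 := by ring
        _ ≤ m₀ * ε ^ 2 / 4 := by gcongr
    calc _ ≤ 2 * L ^ 2 * (2 * (Real.exp (-(κ₁ * ε ^ 2 / 4 * L)) * S₀)) := by gcongr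
      _ = 4 * S₀ * (L ^ 2 * Real.exp (-(κ₁ * ε ^ 2 / 4 * L))) := by ring
      _ ≤ 4 * S₀ := mul_le_of_le_one_right (by positivity) h5
  have e5 : T * (4 * Real.exp (-(commitCount (L ^ 2) * Δ ^ 2 / 8))) ≤ 4 := by
    have : Real.exp (-(commitCount (L ^ 2) * Δ ^ 2 / 8)) ≤ Real.exp (-(Δ ^ 2 / 8 * L ^ 2)) := by
      refine Real.exp_le_exp.2 (neg_le_neg ?_)
      calc Δ ^ 2 / 8 * L ^ 2 = L ^ 2 * Δ ^ 2 / 8 := by ring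
        _ ≤ commitCount (L ^ 2) * Δ ^ 2 / 8 := by gcongr
    calc _ ≤ T * (4 * Real.exp (-(Δ ^ 2 / 8 * L ^ 2))) := by gcongr
      _ = 4 * Real.exp (L - Δ ^ 2 / 8 * L ^ 2) := by
        rw [sub_eq_add_neg, Real.exp_add, ← hexpT]; ring
      _ ≤ 4 := by linarith
  have e6 : 16 * commitCount (L ^ 2) * S₃ / L ^ 2 ≤ 32 * S₃ := by
    rw [div_le_iff₀ (by positivity)]
    calc 16 * commitCount (L ^ 2) * S₃ ≤ 16 * (2 * L ^ 2) * S₃ := by gcongr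
      _ = 32 * S₃ * L ^ 2 := by ring
  have hηκ : κ * L = κ₁ * L + η * L + η * L := by rw [hη]; ring
  linarith

theorem eventually_le_integral_armCount {κ : ℝ} (hκ0 : 0 < κ) (hκ : κ < 2 / Δ ^ 2) :
    ∀ᶠ T : ℕ in atTop, κ * Real.log T ≤
      ∫ ω, (armCount tie T (Real.log T ^ 2) b fun k n => X k n ω : ℝ) ∂P := by
  obtain ⟨κ₁, hκκ₁, hκ₁⟩ := exists_between hκ
  have hκ₁0 : 0 < κ₁ := hκ0.trans hκκ₁
  -- `ε` is so small that `κ₁ log T` pulls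
  -- with averages at distance `Δ + 2ε` do not end Stage III
  obtain ⟨ε, hε1, hε0⟩ : ∃ ε : ℝ, κ₁ * (Δ + 2 * ε) ^ 2 < 2 ∧ 0 < ε := by
    have h1 : ∀ᶠ ε : ℝ in 𝓝 0, κ₁ * (Δ + 2 * ε) ^ 2 < 2 := by
      have hc : Continuous fun ε : ℝ => κ₁ * (Δ + 2 * ε) ^ 2 := by fun_prop
      refine hc.continuousAt.eventually_lt_const ?_
      rw [lt_div_iff₀ (by positivity)] at hκ₁
      simpa using hκ₁
    exact ((h1.filter_mono nhdsWithin_le_nhds).and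
      (self_mem_nhdsWithin (s := Set.Ioi (0 : ℝ)))).exists
  set S₁ := expSeries 1 (Δ ^ 2 / 8)
  have hS₁ : 0 ≤ S₁ := expSeries_nonneg _ _
  set c := (2 - κ₁ * (Δ + 2 * ε) ^ 2) / 2 with hc
  have hc0 : 0 < c := by linarith
  set ρ := (κ₁ - κ) / (6 * κ₁) with hρ
  have hρ0 : 0 < ρ := div_pos (by linarith) (by linarith)
  have hreal : ∀ᶠ L : ℝ in atTop, 1 ≤ L ∧ Real.log (κ₁ * L) ≤ c * L ∧
      8 * S₁ / L ^ 2 ≤ ρ ∧ 2 * Real.exp (L - ε ^ 2 / 2 * L ^ 2) ≤ ρ ∧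
      4 * κ₁ * Real.exp (ε ^ 2 / 2) * (L ^ 3 * Real.exp (-(κ₁ * ε ^ 2 / 2 * L))) ≤ ρ ∧
      4 * L ^ 2 + κ₁ * L ≤ Real.exp L ∧ 1 ≤ (κ₁ - κ) / 2 * L := by
    have hlog : ∀ᶠ L : ℝ in atTop, Real.log (κ₁ * L) ≤ c / κ₁ * (κ₁ * L) :=
      (tendsto_id.const_mul_atTop hκ₁0).eventually (eventually_log_le (by positivity))
    filter_upwards [eventually_ge_atTop 1, hlog,
      eventually_ge_atTop (8 * S₁ / ρ),
      eventually_exp_sub_sq_le (c := ε ^ 2 / 2) (ρ := ρ / 2) (by positivity) (by positivity),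
      eventually_pow_mul_exp_le 3 (c := κ₁ * ε ^ 2 / 2)
        (ρ := ρ / (4 * κ₁ * Real.exp (ε ^ 2 / 2))) (by positivity) (by positivity),
      eventually_pow_mul_exp_le 2 (c := 1) (ρ := 1 / (4 + κ₁)) one_pos (by positivity),
      eventually_ge_atTop (2 / (κ₁ - κ))] with L h1 h2 h3 h4 h5 h6 h7
    refine ⟨h1, ?_, ?_, by linarith, ?_, ?_, ?_⟩
    · rwa [← mul_assoc, div_mul_cancel₀ _ hκ₁0.ne'] at h2
    · rw [div_le_iff₀ hρ0] at h3
      rw [div_le_iff₀ (by positivity)]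
      nlinarith [mul_nonneg hρ0.le (show 0 ≤ L ^ 2 - L by nlinarith)]
    · rwa [le_div_iff₀' (by positivity)] at h5
    · rw [one_mul, Real.exp_neg, ← div_eq_mul_inv, div_le_div_iff₀ (Real.exp_pos _)
        (by positivity)] at h6
      nlinarith [mul_nonneg hκ₁0.le (show 0 ≤ L ^ 2 - L by nlinarith)]
    · rw [div_le_iff₀ (by linarith)] at h7
      linarith
  filter_upwards [tendsto_log_natCast.eventually hreal, eventually_ge_atTop 2] with T hT hT2
  have hT0 : (0 : ℝ) < T := by exact_mod_cast (by omega : 0 < T)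
  have hexpT : (T : ℝ) = Real.exp (Real.log T) := (Real.exp_log hT0).symm
  set L := Real.log T with hL
  obtain ⟨h1, h2, h3, h4, h5, h6, h7⟩ := hT
  have hL0 : 0 < L := by linarith
  set M := ⌊κ₁ * L⌋₊ with hM
  have hMu : (M : ℝ) ≤ κ₁ * L := Nat.floor_le (by positivity)
  have hMl : κ₁ * L - 1 ≤ M := (Nat.sub_one_lt_floor _).le
  have hN1 : L ^ 2 ≤ commitCount (L ^ 2) := (lt_commitCount _).le
  have hN2 : (commitCount (L ^ 2) : ℝ) ≤ 2 * L ^ 2 :=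
    (commitCount_le (by positivity)).trans (by nlinarith)
  have hMT : 2 * commitCount (L ^ 2) + M ≤ T := by
    have : (2 * commitCount (L ^ 2) + M : ℝ) ≤ T := by rw [hexpT]; linarith
    exact_mod_cast this
  have hr : ∀ m : ℕ, 1 ≤ m → m < M → (Δ + 2 * ε) ^ 2 * M ≤ m * radiusIII T m ^ 2 := by
    intro m hm hmM
    refine le_trans ?_ (le_mul_radiusIII_sq hm (by omega))
    have ha : Real.log m ≤ Real.log (κ₁ * L) := by
      apply Real.log_le_log (by exact_mod_cast hm)
      exact le_trans (by exact_mod_cast hmM.le) hMu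
    have hb' : (Δ + 2 * ε) ^ 2 * M ≤ (Δ + 2 * ε) ^ 2 * (κ₁ * L) := by gcongr
    have h10 : c * L = L - (Δ + 2 * ε) ^ 2 * (κ₁ * L) / 2 := by rw [hc]; ring
    rw [← hL]
    linarith
  refine le_trans ?_ (le_integral_armCount hν hX hΔ hb tie (T₁ := L ^ 2) (by omega)
    (by positivity) hε0.le hMT hr)
  have e1 : 2 * Real.exp (-(commitCount (L ^ 2) * ε ^ 2 / 2)) ≤ ρ := by
    refine le_trans (mul_le_mul_of_nonneg_left (Real.exp_le_exp.2 ?_) zero_le_two) h4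
    have : L ^ 2 * ε ^ 2 / 2 ≤ commitCount (L ^ 2) * ε ^ 2 / 2 := by gcongr
    linarith
  have e2 : M * (commitCount (L ^ 2) * (2 * Real.exp (-(M * ε ^ 2 / 2)))) ≤ ρ := by
    have : Real.exp (-(M * ε ^ 2 / 2)) ≤
        Real.exp (ε ^ 2 / 2) * Real.exp (-(κ₁ * ε ^ 2 / 2 * L)) := by
      rw [← Real.exp_add]
      apply Real.exp_le_exp.2
      have : (κ₁ * L - 1) * ε ^ 2 / 2 ≤ M * ε ^ 2 / 2 := by gcongr
      linarith
    calc _ ≤ κ₁ * L * (2 * L ^ 2 * (2 * (Real.exp (ε ^ 2 / 2) *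
          Real.exp (-(κ₁ * ε ^ 2 / 2 * L))))) := by gcongr
      _ = 4 * κ₁ * Real.exp (ε ^ 2 / 2) * (L ^ 3 * Real.exp (-(κ₁ * ε ^ 2 / 2 * L))) := by ring
      _ ≤ ρ := h5
  have hρ' : κ₁ * L * (3 * ρ) = (κ₁ - κ) / 2 * L := by rw [hρ]; field_simp; ring
  have hM0 : (0 : ℝ) ≤ M := Nat.cast_nonneg _
  calc κ * L ≤ κ₁ * L - 1 - κ₁ * L * (3 * ρ) := by rw [hρ']; linarith
    _ ≤ M - M * (3 * ρ) := by gcongr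
    _ = M * (1 - 3 * ρ) := by ring
    _ ≤ _ := by gcongr; linarith

end Limits

end DETC

end

theorem theorem2 (ν : Fin 2 → Measure ℝ) [∀ k, IsProbabilityMeasure (ν k)]
    (hν : ∀ k, DETC.IsOneSubgaussian ν k)
    (Δ : ℝ) (hΔ : Δ = |DETC.mean ν 0 - DETC.mean ν 1|) (hpos : 0 < Δ)
    {Ω : Type*} [MeasurableSpace Ω] (P : Measure Ω) [IsProbabilityMeasure P]
    (X : Fin 2 → ℕ → Ω → ℝ) (hX : DETC.IsRewardTable P ν X) (tie : Fin 2) :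
    Tendsto (fun T : ℕ => DETC.regret P ν X tie T (Real.log T ^ 2) / Real.log T)
      atTop (𝓝 (2 / Δ)) := by
  obtain ⟨b, hb⟩ : ∃ b : Fin 2, DETC.mean ν (1 - b) = DETC.mean ν b + Δ := by
    rcases le_total (DETC.mean ν 0) (DETC.mean ν 1) with h | h
    · refine ⟨0, ?_⟩
      rw [abs_of_nonpos (sub_nonpos.2 h)] at hΔ
      rw [hΔ, show (1 : Fin 2) - 0 = 1 from rfl]; ring
    · refine ⟨1, ?_⟩
      rw [abs_of_nonneg (sub_nonneg.2 h)] at hΔ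
      rw [hΔ, show (1 : Fin 2) - 1 = 0 from rfl]; ring
  have h2 : 2 / Δ / Δ = 2 / Δ ^ 2 := by rw [div_div, sq]
  refine tendsto_order.2 ⟨fun a ha => ?_, fun a ha => ?_⟩
  · obtain ⟨κ, hκ, hκ'⟩ := exists_between (show max 0 (a / Δ) < 2 / Δ ^ 2 from
      max_lt (by positivity) (h2 ▸ div_lt_div_of_pos_right ha hpos))
    obtain ⟨hκ0, hκa⟩ := max_lt_iff.1 hκ
    filter_upwards [DETC.eventually_le_integral_armCount hν hX hpos hb tie hκ0 hκ',
      DETC.tendsto_log_natCast.eventually_gt_atTop 0, eventually_ge_atTop 1] with T hT hL hT1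
    rw [DETC.regret_eq hν hX tie hT1 (sq_nonneg _) hpos.le hb, lt_div_iff₀ hL]
    rw [div_lt_iff₀ hpos] at hκa
    calc a * Real.log T < κ * Δ * Real.log T := by gcongr
      _ = Δ * (κ * Real.log T) := by ring
      _ ≤ _ := by gcongr
  · obtain ⟨κ, hκ, hκa⟩ := exists_between (show 2 / Δ ^ 2 < a / Δ from
      h2 ▸ div_lt_div_of_pos_right ha hpos)
    filter_upwards [DETC.eventually_integral_armCount_le hν hX hpos hb tie hκ,
      DETC.tendsto_log_natCast.eventually_gt_atTop 0, eventually_ge_atTop 1] with T hT hL hT1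
    rw [DETC.regret_eq hν hX tie hT1 (sq_nonneg _) hpos.le hb, div_lt_iff₀ hL]
    rw [lt_div_iff₀ hpos] at hκa
    calc _ ≤ Δ * (κ * Real.log T) := by gcongr
      _ = κ * Δ * Real.log T := by ring
      _ < a * Real.log T := by gcongr
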